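/- Let $\mathcal F$ be an ordinary differential field of characteristic $0$, and let $u$ be an element of a differential extension field of $\mathcal F$ that is differentially transcendental over $\mathcal F$. For $S$ in such an extension, $\mathcal F\langle S\rangle$ denotes the differential field generated by $S$ over $\mathcal F$, and $\mathcal F\{u\}$, $\mathcal F\{x,y\}$ denote rings of differential polynomials. The order $\mathrm{ord}_z f$ of a differential polynomial $f$ in a differential variable $z$ is the largest $k$ such that $z^{(k)}$ occurs in $f$, and $-\infty$ if there is none. A linear differential rational parametrization is a pair $$\mathcal P(u)=\left(\frac{P_1(u)}{Q_1(u)},\frac{P_2(u)}{Q_2(u)}\right)\in\mathcal F\langle u\rangle^2\setminus\mathcal F^2,$$ where $P_i,Q_i\in\mathcal F\{u\}$ have total degree at most $1$, $Q_i\neq 0$ and $\gcd(P_i,Q_i)=1$ for $i=1,2$. Its orders are $m_i=\mathrm{ord}(P_i/Q_i):=\max\{\mathrm{ord}_uP_i,\mathrm{ord}_uQ_i\}$. It is called proper if $\mathcal F\langle P_1(u)/Q_1(u),P_2(u)/Q_2(u)\rangle=\mathcal F\langle u\rangle$. For differential polynomials $f_1,f_2\in\mathbb D\{u\}$ of degree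 one and of orders $m_1,m_2\ge 0$ over a differential domain $\mathbb D$, the differential resultant $\delta\text{-}\mathrm{Res}_u(f_1,f_2)\in\mathbb D$ is the determinant of the $(m_1+m_2+2)\times(m_1+m_2+2)$ matrix whose rows are the coefficient vectors of $f_1^{(m_2)},\dots,f_1',f_1,f_2^{(m_1)},\dots,f_2',f_2$, in this order, with respect to $u^{(m_1+m_2)},\dots,u',u,1$. Theorem. Let $\mathcal P(u)$ be a proper linear differential rational parametrization with $m_1\ge 0$ and $m_2\ge 0$. Then, with $\mathbb D=\mathcal F\{x,y\}$, the differential resultant $$R(x,y)=\delta\text{-}\mathrm{Res}_u\bigl(xQ_1(u)-P_1(u),\;yQ_2(u)-P_2(u)\bigr)\in\mathcal F\{x,y\}$$ is nonzero, and $\mathrm{ord}_xR=m_2$ and $\mathrm{ord}_yR=m_1$. Moreover, $R$ has degree exactly $1$ in $x^{(m_2)}$ and degree exactly $1$ in $y^{(m_1)}$. -/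

import Mathlib

open scoped Differential

noncomputable section

namespace DiffAlg

/-- The ring `R{y_i : i ∈ ι}` of differential polynomials over `R`: the polynomial ring in the
derivatives `y_i^{(k)}`, where the variable indexed by `(i, k)` stands for `y_i^{(k)}`. -/
abbrev DiffPoly (ι R : Type*) [CommRing R] : Type _ := MvPolynomial (ι × ℕ) R

section Derivation

variable {ι R : Type*} [CommRing R] [Differential R]

/-- Apply the derivation of `R` to every coefficient of a polynomial. -/
def coeffDeriv (p : DiffPoly ι R) : DiffPoly ι R :=
  ∑ m ∈ p.support, MvPolynomial.monomial m ((p.coeff m)′)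

theorem coeff_coeffDeriv (p : DiffPoly ι R) (m : ι × ℕ →₀ ℕ) :
    (coeffDeriv p).coeff m = (p.coeff m)′ := by
  classical
  simp only [coeffDeriv, MvPolynomial.coeff_sum, MvPolynomial.coeff_monomial,
    Finset.sum_ite_eq', MvPolynomial.mem_support_iff]
  split_ifs with h
  · rfl
  · rw [not_not.mp h, map_zero]

theorem coeffDeriv_add (p q : DiffPoly ι R) :
    coeffDeriv (p + q) = coeffDeriv p + coeffDeriv q := by
  ext m
  simp [coeff_coeffDeriv]

theorem coeffDeriv_mul (p q : DiffPoly ι R) :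
    coeffDeriv (p * q) = p * coeffDeriv q + q * coeffDeriv p := by
  classical
  ext m
  rw [coeff_coeffDeriv, mul_comm q, MvPolynomial.coeff_add, MvPolynomial.coeff_mul,
    MvPolynomial.coeff_mul, MvPolynomial.coeff_mul, map_sum, ← Finset.sum_add_distrib]
  refine Finset.sum_congr rfl fun x _ => ?_
  rw [Derivation.leibniz, coeff_coeffDeriv, coeff_coeffDeriv, smul_eq_mul, smul_eq_mul,
    mul_comm (q.coeff x.2)]

/-- The derivation of `R{y_i : i ∈ ι}`: it extends the derivation of `R` and sends
`y_i^{(k)}` to `y_i^{(k+1)}`. -/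
instance instDifferentialDiffPoly : Differential (DiffPoly ι R) where
  deriv := Derivation.mk'
    (AddMonoidHom.toIntLinearMap
      { toFun := fun p => coeffDeriv p +
          MvPolynomial.mkDerivation R
            (fun v : ι × ℕ => (MvPolynomial.X (v.1, v.2 + 1) : DiffPoly ι R)) p
        map_zero' := by simp [coeffDeriv]
        map_add' := fun p q => by rw [coeffDeriv_add, map_add]; abel })
    (fun p q => by
      simp only [AddMonoidHom.coe_toIntLinearMap, AddMonoidHom.coe_mk, ZeroHom.coe_mk,
        coeffDeriv_mul, Derivation.leibniz, smul_eq_mul]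
      ring)

end Derivation

/-- The `n`-th derivative `a^{(n)}`. -/
def iterDeriv {R : Type*} [CommRing R] [Differential R] (n : ℕ) (a : R) : R :=
  (fun b : R => b′)^[n] a

open Classical in
/-- The order `ord_{y_i} f` of a differential polynomial: the largest `k` such that `y_i^{(k)}`
occurs in `f`, and `-∞ = ⊥` if no derivative of `y_i` occurs. -/
def ord {ι R : Type*} [CommRing R] (i : ι) (f : DiffPoly ι R) : WithBot ℕ :=
  (f.vars.filter fun v => v.1 = i).sup fun v => (v.2 : WithBot ℕ)

section Parametrization

variable {F E : Type*} [Field F] [Differential F] [Field E] [Differential E] [Algebra F E]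

/-- The differential subfield `F⟨S⟩` of `E` generated by `S` over `F`. -/
def diffAdjoin (F : Type*) {E : Type*} [Field F] [Field E] [Differential E] [Algebra F E]
    (S : Set E) : IntermediateField F E :=
  IntermediateField.adjoin F {b | ∃ a ∈ S, ∃ k : ℕ, b = iterDeriv k a}

/-- `u` is differentially transcendental over `F`. -/
def IsDiffTranscendental (F : Type*) {E : Type*} [Field F] [Field E] [Differential E]
    [Algebra F E] (u : E) : Prop :=
  AlgebraicIndependent F fun k : ℕ => iterDeriv k u

/-- The value `P(u)` of a differential polynomial `P` in one differential variable. -/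
def diffEval (u : E) (P : DiffPoly Unit F) : E :=
  MvPolynomial.aeval (fun v : Unit × ℕ => iterDeriv v.2 u) P

/-- The order of the fraction `P/Q` in reduced form. -/
def fracOrd (P Q : DiffPoly Unit F) : WithBot ℕ :=
  max (ord () P) (ord () Q)

/-- `(P₁(u)/Q₁(u), P₂(u)/Q₂(u))` is a linear differential rational parametrization: a point of
`F⟨u⟩² \ F²` given by fractions in reduced form whose numerators and denominators have degree
at most one. -/
structure IsLinearDiffRatParam (u : E) (P₁ Q₁ P₂ Q₂ : DiffPoly Unit F) : Prop where
  denom_ne_zero₁ : Q₁ ≠ 0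
  denom_ne_zero₂ : Q₂ ≠ 0
  degree_num₁ : P₁.totalDegree ≤ 1
  degree_denom₁ : Q₁.totalDegree ≤ 1
  degree_num₂ : P₂.totalDegree ≤ 1
  degree_denom₂ : Q₂.totalDegree ≤ 1
  reduced₁ : IsRelPrime P₁ Q₁
  reduced₂ : IsRelPrime P₂ Q₂
  not_both_const : ¬ (diffEval u P₁ / diffEval u Q₁ ∈ (algebraMap F E).range ∧
    diffEval u P₂ / diffEval u Q₂ ∈ (algebraMap F E).range)

/-- The parametrization `(P₁(u)/Q₁(u), P₂(u)/Q₂(u))` is proper: it generates `F⟨u⟩`. -/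
def IsProperParam (u : E) (P₁ Q₁ P₂ Q₂ : DiffPoly Unit F) : Prop :=
  diffAdjoin F {diffEval u P₁ / diffEval u Q₁, diffEval u P₂ / diffEval u Q₂} =
    diffAdjoin F {u}

end Parametrization

section Resultant

variable {D : Type*} [CommRing D] [Differential D]

/-- The differential resultant matrix of linear `f₁, f₂ ∈ D{u}` of orders `m₁, m₂`: the rows are
the coefficient vectors of `f₁^{(m₂)}, …, f₁', f₁, f₂^{(m₁)}, …, f₂', f₂` with respect to
`u^{(m₁+m₂)}, …, u', u, 1`. -/
def diffResultantMatrix (m₁ m₂ : ℕ) (f₁ f₂ : DiffPoly Unit D) :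
    Matrix (Fin (m₁ + m₂ + 2)) (Fin (m₁ + m₂ + 2)) D :=
  Matrix.of fun k c =>
    let p : DiffPoly Unit D :=
      if (k : ℕ) ≤ m₂ then iterDeriv (m₂ - k) f₁ else iterDeriv (m₁ + m₂ + 1 - k) f₂
    if (c : ℕ) ≤ m₁ + m₂ then p.coeff (Finsupp.single ((), m₁ + m₂ - c) 1) else p.coeff 0

/-- The differential resultant `δ-Res_u(f₁, f₂)` of linear differential polynomials in `D{u}`
(meant for `f₁, f₂` of nonnegative order in `u`). -/
def diffResultant (f₁ f₂ : DiffPoly Unit D) : D :=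
  (diffResultantMatrix ((ord () f₁).unbotD 0) ((ord () f₂).unbotD 0) f₁ f₂).det

end Resultant

/-- For `P, Q ∈ F{u}` and `i = 0, 1`, the polynomial `x Q(u) - P(u)`, respectively
`y Q(u) - P(u)`, in `F{x, y}{u}`, where `F{x, y}` is `DiffPoly (Fin 2) F` with `x` the variable
indexed by `0` and `y` the one indexed by `1`. -/
def implicitEq {F : Type*} [Field F] (i : Fin 2) (P Q : DiffPoly Unit F) :
    DiffPoly Unit (DiffPoly (Fin 2) F) :=
  MvPolynomial.C (MvPolynomial.X (i, 0)) * MvPolynomial.map MvPolynomial.C Q -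
    MvPolynomial.map MvPolynomial.C P

end DiffAlg

end

/-! Put ξ = P₁(u)/Q₁(u) and η = P₂(u)/Q₂(u). An affine form is a constant plus a linear operator in
E[∂]. Operators are stored as polynomials in X = ∂, of which only the E-module structure and left
multiplication by ∂ (`twist`) are used; a left ideal is a `twist`-stable E-submodule.

The variable x^(m₂) occurs in R only through the row of f₁^(m₂), and linearly. Its coefficient is
the determinant with that row replaced by the coefficients of Q₁ (`degreeOf_det`), so it suffices
that this determinant is nonzero after x ↦ ξ, y ↦ η. There every other row is an affine form
vanishing at u, while Q₁(u) ≠ 0, so a linear relation among the rows cannot involve the new one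
(`det_updateRow_derivSeq_ne_zero`). Let α, β be the linear parts of ξQ₁ - P₁ and ηQ₂ - P₂. What
remains is the independence of the ∂ʲα (j < m₂) and the ∂ʲβ (j ≤ m₁).

This is where properness enters. Let d be the differential of F⟨u⟩ over F, with d u^(k) = ∂ᵏ.
Differentiating ξQ₁(u) = P₁(u) gives Q₁(u) dξ = -α, and similarly for β. Since F⟨ξ, η⟩ = F⟨u⟩, the
differentials dξ, dη, hence α, β, generate E[∂] as a left ideal (`eq_top_of_diffAdjoin_eq`). The
quotient E[∂]/E[∂]β has dimension m₂ over E and is generated by the class of α under ∂. If some ∂ᵏα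
with k < m₂ depended on the earlier ones, their span would be ∂-stable, hence the whole quotient,
which is too large (`iterate_twist_notMem`). The variable y^(m₁) is treated symmetrically. -/

noncomputable section

namespace DiffAlg

open Polynomial

/-! ### Linear differential operators and left multiplication by ∂ -/

section Twist

variable {D : Type*} [CommRing D] [Differential D]

theorem iterDeriv_succ (n : ℕ) (a : D) : iterDeriv (n + 1) a = (iterDeriv n a)′ :=
  Function.iterate_succ_apply' _ _ _

theorem iterDeriv_zero_right (n : ℕ) : iterDeriv n (0 : D) = 0 := by
  induction n with
  | zero => rfl
  | succ n ih => rw [iterDeriv_succ, ih, map_zero]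

/-- The operator `p ↦ ∂ ∘ p` on linear differential operators `p = ∑ pₖ ∂ᵏ`, where `∂ᵏ` is
written `Xᵏ`. -/
def twist : D[X] →+ D[X] where
  toFun p := p.sum (fun k a => monomial k a′) + X * p
  map_zero' := by simp
  map_add' p q := by
    rw [Polynomial.sum_add_index p q _ (by simp) (by simp)]
    ring

theorem coeff_sum_deriv (p : D[X]) (k : ℕ) :
    (p.sum fun k a => monomial k a′).coeff k = (p.coeff k)′ := by
  simp only [Polynomial.sum, finsetSum_coeff, coeff_monomial, Finset.sum_ite_eq',
    mem_support_iff]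
  split_ifs with h
  · rfl
  · rw [notMem_support_iff.mp h, map_zero]

theorem twist_coeff_zero (p : D[X]) : (twist p).coeff 0 = (p.coeff 0)′ := by
  change (p.sum (fun k a => monomial k a′) + X * p).coeff 0 = _
  rw [coeff_add, coeff_sum_deriv, coeff_X_mul_zero, add_zero]

theorem twist_coeff_succ (p : D[X]) (k : ℕ) :
    (twist p).coeff (k + 1) = (p.coeff (k + 1))′ + p.coeff k := by
  change (p.sum (fun k a => monomial k a′) + X * p).coeff (k + 1) = _
  rw [coeff_add, coeff_sum_deriv, coeff_X_mul]

theorem twist_smul (a : D) (p : D[X]) : twist (a • p) = a′ • p + a • twist p := by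
  ext k
  cases k with
  | zero => simp [twist_coeff_zero]; ring
  | succ k => simp [twist_coeff_succ]; ring

theorem twist_X_pow (k : ℕ) : twist (X ^ k : D[X]) = X ^ (k + 1) := by
  ext j
  cases j with
  | zero => simp [twist_coeff_zero, coeff_X_pow]; split_ifs <;> simp
  | succ j => simp [twist_coeff_succ, coeff_X_pow]; split_ifs <;> simp_all

theorem twist_map {E : Type*} [CommRing E] [Differential E] (σ : D →+* E)
    (hσ : ∀ a, σ a′ = (σ a)′) (p : D[X]) : twist (p.map σ) = (twist p).map σ := by
  ext k
  cases k with
  | zero => simp [twist_coeff_zero, hσ]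
  | succ k => simp [twist_coeff_succ, hσ]

theorem iterate_twist_map {E : Type*} [CommRing E] [Differential E] (σ : D →+* E)
    (hσ : ∀ a, σ a′ = (σ a)′) (j : ℕ) (p : D[X]) :
    twist^[j] (p.map σ) = (twist^[j] p).map σ := by
  induction j with
  | zero => rfl
  | succ j ih => rw [Function.iterate_succ_apply', ih, twist_map σ hσ,
      Function.iterate_succ_apply']

theorem map_iterDeriv {E : Type*} [CommRing E] [Differential E] (σ : D →+* E)
    (hσ : ∀ a, σ a′ = (σ a)′) (j : ℕ) (a : D) : σ (iterDeriv j a) = iterDeriv j (σ a) := by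
  induction j with
  | zero => rfl
  | succ j ih => rw [iterDeriv_succ, hσ, ih, iterDeriv_succ]

theorem natDegree_twist_le {p : D[X]} {n : ℕ} (h : p.natDegree ≤ n) :
    (twist p).natDegree ≤ n + 1 := by
  rw [natDegree_le_iff_coeff_eq_zero] at h ⊢
  intro N hN
  cases N with
  | zero => omega
  | succ N => rw [twist_coeff_succ, h _ (by omega), h _ (by omega), map_zero, add_zero]

theorem natDegree_iterate_twist_le {p : D[X]} {n : ℕ} (h : p.natDegree ≤ n) (j : ℕ) :
    (twist^[j] p).natDegree ≤ n + j := by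
  induction j with
  | zero => exact h
  | succ j ih =>
    rw [Function.iterate_succ_apply']
    exact natDegree_twist_le ih

/-- Since ∂a = a∂ + a′, multiplying by ∂ shifts the leading coefficient without changing it. -/
theorem coeff_iterate_twist {p : D[X]} {n : ℕ} (h : p.natDegree ≤ n) (j : ℕ) :
    (twist^[j] p).coeff (n + j) = p.coeff n := by
  induction j with
  | zero => rfl
  | succ j ih =>
    rw [Function.iterate_succ_apply', ← add_assoc, twist_coeff_succ, ih,
      coeff_eq_zero_of_natDegree_lt
        (lt_of_le_of_lt (natDegree_iterate_twist_le h j) (Nat.lt_succ_self _)), map_zero, zero_add]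

/-- The value `∑ pₖ u⁽ᵏ⁾` of the linear differential operator `∑ pₖ ∂ᵏ` at `u`. -/
def applyOp (u : D) : D[X] →ₗ[D] D :=
  Polynomial.lsum fun k => LinearMap.toSpanSingleton D D (iterDeriv k u)

theorem applyOp_X_pow (u : D) (k : ℕ) : applyOp u (X ^ k) = iterDeriv k u := by
  rw [X_pow_eq_monomial]
  simp [applyOp]

theorem applyOp_monomial (u : D) (k : ℕ) (a : D) :
    applyOp u (monomial k a) = a * iterDeriv k u := by
  simp [applyOp]

theorem applyOp_twist (u : D) (p : D[X]) : applyOp u (twist p) = (applyOp u p)′ := by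
  induction p using Polynomial.induction_on' with
  | add p q hp hq => simp [map_add, hp, hq]
  | monomial k a =>
    have : (monomial k a : D[X]) = a • X ^ k := by rw [smul_X_eq_monomial]
    rw [this, twist_smul, twist_X_pow]
    simp only [map_add, map_smul, applyOp_X_pow, iterDeriv_succ, smul_eq_mul, Derivation.leibniz]
    ring

theorem applyOp_iterate_twist (u : D) (p : D[X]) (j : ℕ) :
    applyOp u (twist^[j] p) = iterDeriv j (applyOp u p) := by
  induction j with
  | zero => rfl
  | succ j ih => rw [Function.iterate_succ_apply', applyOp_twist, ih, iterDeriv_succ]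

theorem iterDeriv_add (j : ℕ) (a b : D) :
    iterDeriv j (a + b) = iterDeriv j a + iterDeriv j b := by
  induction j with
  | zero => rfl
  | succ j ih => simp only [iterDeriv_succ, ih, map_add]

end Twist

/-! ### Affine differential polynomials in u -/

section Aff

variable {ι D : Type*} [CommRing D]

/-- The linear form `∑ pₖ u⁽ᵏ⁾` in `D{u}`. -/
def lin : D[X] →ₗ[D] DiffPoly Unit D :=
  Polynomial.lsum fun k => MvPolynomial.monomial (Finsupp.single ((), k) 1)

theorem lin_monomial (k : ℕ) (a : D) :
    lin (monomial k a) = MvPolynomial.monomial (Finsupp.single ((), k) 1) a := by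
  simp [lin]

theorem coeff_single_lin (p : D[X]) (k : ℕ) :
    MvPolynomial.coeff (Finsupp.single ((), k) 1) (lin p) = p.coeff k := by
  induction p using Polynomial.induction_on' with
  | add p q hp hq => simp [map_add, hp, hq]
  | monomial j a =>
    rw [lin_monomial, MvPolynomial.coeff_monomial, coeff_monomial]
    simp [Finsupp.single_left_inj]

theorem coeff_zero_lin (p : D[X]) : MvPolynomial.coeff 0 (lin p) = 0 := by
  induction p using Polynomial.induction_on' with
  | add p q hp hq => simp [map_add, hp, hq]
  | monomial j a => simp [lin_monomial, MvPolynomial.coeff_monomial]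

/-- The affine form `a + ∑ pₖ u⁽ᵏ⁾` in `D{u}`. -/
def aff (a : D) (p : D[X]) : DiffPoly Unit D := MvPolynomial.C a + lin p

theorem coeff_single_aff (a : D) (p : D[X]) (k : ℕ) :
    MvPolynomial.coeff (Finsupp.single ((), k) 1) (aff a p) = p.coeff k := by
  classical
  rw [aff, MvPolynomial.coeff_add, coeff_single_lin, MvPolynomial.coeff_C, if_neg, zero_add]
  intro h
  simpa using DFunLike.congr_fun h ((), k)

theorem coeff_zero_aff (a : D) (p : D[X]) : MvPolynomial.coeff 0 (aff a p) = a := by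
  simp [aff, coeff_zero_lin]

theorem exists_eq_aff {f : DiffPoly Unit D} (hf : f.totalDegree ≤ 1) : ∃ a p, f = aff a p := by
  classical
  suffices h : ∀ m ∈ f.support, ∃ a p, MvPolynomial.monomial m (f.coeff m) = aff a p by
    choose! a p h using h
    refine ⟨∑ m ∈ f.support, a m, ∑ m ∈ f.support, p m, ?_⟩
    rw [aff, map_sum, map_sum, ← Finset.sum_add_distrib]
    conv_lhs => rw [f.as_sum]
    exact Finset.sum_congr rfl h
  intro m hm
  have h1 : m.degree ≤ 1 := by
    refine le_trans ?_ hf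
    exact MvPolynomial.le_totalDegree hm
  rcases Nat.le_one_iff_eq_zero_or_eq_one.mp h1 with h0 | h1
  · rw [Finsupp.degree_eq_zero_iff] at h0
    subst h0
    exact ⟨f.coeff 0, 0, by simp [aff]⟩
  · obtain ⟨⟨⟨⟩, k⟩, hv⟩ : m ∈ Set.range fun v : Unit × ℕ => Finsupp.single v 1 := by
      rw [Finsupp.range_single_one]
      exact h1
    dsimp only at hv
    refine ⟨0, monomial k (f.coeff m), ?_⟩
    rw [aff, lin_monomial, hv, map_zero, zero_add]

theorem mem_vars_aff (a : D) (p : D[X]) (v : Unit × ℕ) :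
    v ∈ (aff a p).vars ↔ v.2 ∈ p.support := by
  classical
  obtain ⟨⟨⟩, k⟩ := v
  constructor
  · intro h
    have h2 := MvPolynomial.vars_add_subset _ _ h
    rw [MvPolynomial.vars_C, Finset.empty_union, MvPolynomial.mem_vars_iff_mem_support] at h2
    obtain ⟨m, hm, hk⟩ := h2
    have h3 : ∀ m ∈ (lin p).support, ∃ j, m = Finsupp.single ((), j) 1 := by
      have : lin p = ∑ j ∈ p.support, MvPolynomial.monomial (Finsupp.single ((), j) 1) (p.coeff j) := by
        conv_lhs => rw [p.as_sum_support]
        rw [map_sum]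
        exact Finset.sum_congr rfl fun j _ => lin_monomial _ _
      intro m hm
      rw [this] at hm
      obtain ⟨j, -, hj⟩ := Finset.mem_biUnion.mp (MvPolynomial.support_sum hm)
      exact ⟨j, Finset.mem_singleton.mp (MvPolynomial.support_monomial_subset hj)⟩
    obtain ⟨j, rfl⟩ := h3 m hm
    have : k = j := by
      by_contra hne
      rw [Finsupp.mem_support_iff, Finsupp.single_apply, if_neg] at hk
      · exact hk rfl
      · simpa using fun h => hne h.symm
    subst this
    rw [MvPolynomial.mem_support_iff, coeff_single_lin] at hm
    exact mem_support_iff.mpr hm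
  · intro h
    rw [MvPolynomial.mem_vars_iff_mem_support]
    refine ⟨Finsupp.single ((), k) 1, ?_, by simp⟩
    rw [MvPolynomial.mem_support_iff, coeff_single_aff]
    exact mem_support_iff.mp h

/-- The conventions agree at the bottom: both sides are `⊥` when the linear part is zero. -/
theorem ord_aff (a : D) (p : D[X]) : ord () (aff a p) = p.degree := by
  classical
  rw [ord, Polynomial.degree, Finset.max]
  apply le_antisymm
  · refine Finset.sup_le fun v hv => ?_
    have hv : v.2 ∈ p.support := by simpa [mem_vars_aff] using hv
    exact Finset.le_sup (f := fun k : ℕ => (k : WithBot ℕ)) hv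
  · refine Finset.sup_le fun k hk => ?_
    refine Finset.le_sup (f := fun v : Unit × ℕ => (v.2 : WithBot ℕ)) (b := ((), k)) ?_
    simpa [mem_vars_aff] using hk

theorem aeval_aff {E : Type*} [CommRing E] [Differential E] [Algebra D E] (u : E)
    (a : D) (p : D[X]) :
    MvPolynomial.aeval (fun v : Unit × ℕ => iterDeriv v.2 u) (aff a p) =
      algebraMap D E a + applyOp u (p.map (algebraMap D E)) := by
  rw [aff, map_add, MvPolynomial.aeval_C]
  congr 1
  induction p using Polynomial.induction_on' with
  | add p q hp hq => simp [map_add, hp, hq, Polynomial.map_add]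
  | monomial k a =>
    rw [lin_monomial, Polynomial.map_monomial, applyOp_monomial, MvPolynomial.aeval_monomial]
    simp

end Aff

/-! ### Derivatives of affine forms, and the forms xQ - P -/

section DerivAff

variable {ι D : Type*} [CommRing D] [Differential D]

theorem deriv_def (p : DiffPoly ι D) : p′ = coeffDeriv p +
    MvPolynomial.mkDerivation D
      (fun v : ι × ℕ => (MvPolynomial.X (v.1, v.2 + 1) : DiffPoly ι D)) p := rfl

theorem deriv_C (a : D) : (MvPolynomial.C a : DiffPoly ι D)′ = MvPolynomial.C a′ := by
  classical
  rw [deriv_def, MvPolynomial.derivation_C, add_zero]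
  ext m
  rw [coeff_coeffDeriv, MvPolynomial.coeff_C, MvPolynomial.coeff_C]
  split_ifs <;> simp

theorem deriv_X (v : ι × ℕ) :
    (MvPolynomial.X v : DiffPoly ι D)′ = MvPolynomial.X (v.1, v.2 + 1) := by
  classical
  rw [deriv_def, MvPolynomial.mkDerivation_X]
  convert zero_add _
  ext m
  rw [coeff_coeffDeriv, MvPolynomial.coeff_X]
  split_ifs <;> simp

theorem deriv_aff (a : D) (p : D[X]) : (aff a p)′ = aff a′ (twist p) := by
  rw [aff, map_add, deriv_C, aff]
  congr 1
  induction p using Polynomial.induction_on' with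
  | add p q hp hq => simp only [map_add, hp, hq]
  | monomial k a =>
    have h1 : (monomial k a : D[X]) = a • X ^ k := by rw [smul_X_eq_monomial]
    have h2 : ∀ (k : ℕ) (a : D), lin (a • X ^ k : D[X]) = MvPolynomial.C a * MvPolynomial.X ((), k) := by
      intro k a
      rw [smul_X_eq_monomial, lin_monomial, ← MvPolynomial.C_mul_X_eq_monomial]
    rw [h1, twist_smul, twist_X_pow, map_add, h2, h2, h2, Derivation.leibniz, deriv_C, deriv_X,
      smul_eq_mul, smul_eq_mul]
    ring

theorem iterDeriv_aff (j : ℕ) (a : D) (p : D[X]) :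
    iterDeriv j (aff a p) = aff (iterDeriv j a) (twist^[j] p) := by
  induction j with
  | zero => rfl
  | succ j ih => rw [iterDeriv_succ, ih, deriv_aff, iterDeriv_succ, Function.iterate_succ_apply']

/-- The constant term of `x Q(u) - P(u)`, where `a` and `b` are those of `P` and `Q`. -/
def eqConst {F : Type*} [Field F] (i : Fin 2) (a b : F) : DiffPoly (Fin 2) F :=
  MvPolynomial.X (i, 0) * MvPolynomial.C b - MvPolynomial.C a

/-- The linear part of `x Q(u) - P(u)`, where `p` and `q` are those of `P` and `Q`. -/
def eqOp {F : Type*} [Field F] (i : Fin 2) (p q : F[X]) : (DiffPoly (Fin 2) F)[X] :=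
  (MvPolynomial.X (i, 0) : DiffPoly (Fin 2) F) •
      q.map (MvPolynomial.C : F →+* DiffPoly (Fin 2) F) -
    p.map (MvPolynomial.C : F →+* DiffPoly (Fin 2) F)

theorem implicitEq_aff {F : Type*} [Field F] (i : Fin 2) (a b : F) (p q : F[X]) :
    implicitEq i (aff a p) (aff b q) = aff (eqConst i a b) (eqOp i p q) := by
  have h : ∀ p : F[X], MvPolynomial.map (MvPolynomial.C (R := F) (σ := Fin 2 × ℕ)) (lin p) =
      lin (p.map MvPolynomial.C) := by
    intro p
    induction p using Polynomial.induction_on' with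
    | add p q hp hq => simp only [map_add, hp, hq, Polynomial.map_add]
    | monomial k a => rw [lin_monomial, MvPolynomial.map_monomial, Polynomial.map_monomial,
        lin_monomial]
  simp only [implicitEq, aff, eqConst, eqOp, map_add, map_sub, map_mul, map_smul, MvPolynomial.map_C, h,
    MvPolynomial.smul_eq_C_mul]
  ring

theorem coeff_eqOp {F : Type*} [Field F] (i : Fin 2) (p q : F[X]) (k : ℕ) :
    (eqOp i p q).coeff k =
      MvPolynomial.X (i, 0) * MvPolynomial.C (q.coeff k) - MvPolynomial.C (p.coeff k) := by
  simp [eqOp]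

/-- Nothing cancels: x is an indeterminate, so x qₖ - pₖ = 0 forces qₖ = pₖ = 0. Hence the orders
that fix the size of the resultant matrix are those of the fractions. -/
theorem degree_eqOp {F : Type*} [Field F] (i : Fin 2) (p q : F[X]) :
    (eqOp i p q).degree = max p.degree q.degree := by
  classical
  have h : (eqOp i p q).support = p.support ∪ q.support := by
    ext k
    rw [Finset.mem_union, mem_support_iff, mem_support_iff, mem_support_iff, ← not_and_or, not_iff_not,
      coeff_eqOp]
    constructor
    · intro h
      have h1 := congrArg (MvPolynomial.coeff (Finsupp.single (i, 0) 1)) h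
      have h0 := congrArg (MvPolynomial.coeff 0) h
      have hne : (0 : Fin 2 × ℕ →₀ ℕ) ≠ Finsupp.single (i, 0) 1 :=
        fun h => by simpa using DFunLike.congr_fun h (i, 0)
      simp [MvPolynomial.coeff_X_mul', MvPolynomial.coeff_C, hne] at h0 h1
      exact ⟨h0, h1⟩
    · rintro ⟨h1, h2⟩
      simp [h1, h2]
  rw [Polynomial.degree, h, Finset.max_union]
  rfl

end DerivAff

/-! ### Linear independence in E[∂] modulo a left ideal -/

section Independence

variable {E : Type*} [Field E] [Differential E]

/-- Although `twist` is not E-linear, the defect a′p in the Leibniz rule stays in the span, so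
stability can be tested on generators. -/
theorem twist_mem_span {S : Set E[X]} (h : ∀ s ∈ S, twist s ∈ Submodule.span E S) {p : E[X]}
    (hp : p ∈ Submodule.span E S) : twist p ∈ Submodule.span E S := by
  induction hp using Submodule.span_induction with
  | mem s hs => exact h s hs
  | zero => rw [map_zero]; exact Submodule.zero_mem _
  | add p q _ _ hp hq => rw [map_add]; exact Submodule.add_mem _ hp hq
  | smul a p hp ih =>
    rw [twist_smul]
    exact Submodule.add_mem _ (Submodule.smul_mem _ _ hp) (Submodule.smul_mem _ _ ih)

/-- The ∂ʲβ have distinct orders m + j ≥ m, so the coefficient at m + k isolates the last term, and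
the terms are peeled off from the top. -/
theorem eq_zero_of_sum_twist_mem_degreeLT {β : E[X]} {m : ℕ} (hβ : β.natDegree ≤ m)
    (hβ0 : β.coeff m ≠ 0) (b : ℕ → E) (k : ℕ)
    (h : ∑ j ∈ Finset.range k, b j • twist^[j] β ∈ degreeLT E m) : ∀ j < k, b j = 0 := by
  induction k with
  | zero => intro j hj; omega
  | succ k ih =>
    have hk : b k = 0 := by
      have h1 : (∑ j ∈ Finset.range (k + 1), b j • twist^[j] β).coeff (m + k) = 0 :=
        coeff_eq_zero_of_degree_lt
          ((mem_degreeLT.mp h).trans_le (by exact_mod_cast Nat.le_add_right m k))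
      rw [finsetSum_coeff, Finset.sum_range_succ, Finset.sum_eq_zero, zero_add, coeff_smul,
        coeff_iterate_twist hβ, smul_eq_mul] at h1
      · exact (mul_eq_zero.mp h1).resolve_right hβ0
      · intro j hj
        rw [coeff_smul, coeff_eq_zero_of_natDegree_lt, smul_zero]
        have := natDegree_iterate_twist_le hβ j
        have := Finset.mem_range.mp hj
        omega
    rw [Finset.sum_range_succ, hk, zero_smul, add_zero] at h
    intro j hj
    rcases Nat.lt_succ_iff_lt_or_eq.mp hj with hj | rfl
    · exact ih h j hj
    · exact hk

theorem sum_range_of_mem_span {E : Type*} [Field E] {M : Type*} [AddCommGroup M] [Module E M] {v : ℕ → M} {t : M}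
    (h : t ∈ Submodule.span E (Set.range v)) :
    ∃ (b : ℕ → E) (k : ℕ), t = ∑ j ∈ Finset.range k, b j • v j := by
  obtain ⟨c, rfl⟩ := Finsupp.mem_span_range_iff_exists_finsupp.mp h
  refine ⟨c, c.support.sup id + 1, ?_⟩
  refine Finsupp.sum_of_support_subset _ (fun j hj => ?_) _ (by simp)
  exact Finset.mem_range.mpr (Nat.lt_succ_of_le (Finset.le_sup (f := id) hj))

/-- If `α` and `β` generate `E[∂]` as a left ideal, then `∂ᵏ α` is not a combination of the
`∂ʲ β` and of the `∂ʲ α` with `j < k`, as long as `k` is less than the order of `β`. -/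
theorem iterate_twist_notMem {α β : E[X]} {m : ℕ} (hβ : β.natDegree ≤ m) (hβ0 : β.coeff m ≠ 0)
    (hgen : ∀ N : Submodule E E[X], (∀ p ∈ N, twist p ∈ N) → α ∈ N → β ∈ N → N = ⊤)
    {k : ℕ} (hk : k < m) :
    twist^[k] α ∉ Submodule.span E (Set.range (fun j : ℕ => twist^[j] β) ∪
      Set.range (fun j : Fin k => twist^[j] α)) := by
  intro hmem
  set T := Submodule.span E (Set.range (fun j : ℕ => twist^[j] β)) with hT
  -- Multiplication by ∂ sends each generator to the next; the last one goes to ∂ᵏα, which lies in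
  -- the span by the assumption to be refuted.
  have hstable : ∀ p ∈ Submodule.span E (Set.range (fun j : ℕ => twist^[j] β) ∪
      Set.range (fun j : Fin k => twist^[j] α)), twist p ∈ Submodule.span E
        (Set.range (fun j : ℕ => twist^[j] β) ∪ Set.range (fun j : Fin k => twist^[j] α)) := by
    refine fun p hp => twist_mem_span ?_ hp
    rintro s (⟨j, rfl⟩ | ⟨⟨j, hj⟩, rfl⟩)
    · refine Submodule.subset_span (Or.inl ⟨j + 1, ?_⟩)
      exact Function.iterate_succ_apply' _ _ _
    · change twist (twist^[j] α) ∈ _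
      rw [← Function.iterate_succ_apply' twist]
      rcases (Nat.succ_le_of_lt hj).lt_or_eq with h | h
      · exact Submodule.subset_span (Or.inr ⟨⟨j + 1, h⟩, rfl⟩)
      · rw [h]
        exact hmem
  have htop := hgen _ hstable
    (by
      rcases Nat.eq_zero_or_pos k with rfl | h
      · exact hmem
      · exact Submodule.subset_span (Or.inr ⟨⟨0, h⟩, rfl⟩))
    (Submodule.subset_span (Or.inl ⟨0, rfl⟩))
  -- Modulo E[∂]β, the k classes of the ∂ʲα span everything.
  have hspan : Submodule.span E (Set.range fun j : Fin k => T.mkQ (twist^[j] α)) = ⊤ := by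
    rw [Set.range_comp' T.mkQ, ← Submodule.map_span, ← top_le_iff, ← Submodule.range_mkQ T,
      LinearMap.range_eq_map, ← htop, Submodule.span_union, Submodule.map_sup]
    refine sup_le ?_ le_rfl
    rw [← hT, Submodule.mkQ_map_self]
    exact bot_le
  have hfin : Module.Finite E (E[X] ⧸ T) := ⟨by
    rw [← hspan]
    exact Submodule.fg_span (Set.finite_range _)⟩
  have hle : Module.finrank E (E[X] ⧸ T) ≤ k := by
    have := finrank_range_le_card (R := E) fun j : Fin k => T.mkQ (twist^[j] α)
    rwa [Set.finrank, hspan, finrank_top, Fintype.card_fin] at this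
  -- Operators of order less than m inject into the quotient, which therefore has dimension at least
  -- m > k.
  have hinj : Function.Injective (T.mkQ ∘ₗ (degreeLT E m).subtype) := by
    rw [← LinearMap.ker_eq_bot, LinearMap.ker_eq_bot']
    rintro ⟨t, ht⟩ h
    have htT : t ∈ T := by simpa using h
    obtain ⟨b, n, rfl⟩ := sum_range_of_mem_span htT
    have := eq_zero_of_sum_twist_mem_degreeLT hβ hβ0 b n ht
    refine Subtype.ext ?_
    change ∑ j ∈ Finset.range n, b j • twist^[j] β = 0
    refine Finset.sum_eq_zero fun j hj => ?_
    rw [this j (Finset.mem_range.mp hj), zero_smul]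
  have h1 := LinearMap.finrank_le_finrank_of_injective hinj
  rw [(degreeLTEquiv E m).finrank_eq, Module.finrank_fin_fun] at h1
  omega

/-- If `α` and `β` generate `E[∂]` as a left ideal, then the `∂ʲ α` with `j < m` and the
`∂ʲ β` with `j < n` are linearly independent, where `m` is the order of `β`. -/
theorem eq_zero_of_sum_twist_add_sum_twist {α β : E[X]} {m : ℕ} (hβ : β.natDegree ≤ m)
    (hβ0 : β.coeff m ≠ 0)
    (hgen : ∀ N : Submodule E E[X], (∀ p ∈ N, twist p ∈ N) → α ∈ N → β ∈ N → N = ⊤)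
    (a b : ℕ → E) (n : ℕ)
    (h : ∑ j ∈ Finset.range m, a j • twist^[j] α + ∑ j ∈ Finset.range n, b j • twist^[j] β = 0) :
    (∀ j < m, a j = 0) ∧ ∀ j < n, b j = 0 := by
  -- Work modulo E[∂]β: a nonzero last coefficient would put ∂ᵏα in the span excluded by
  -- `iterate_twist_notMem`.
  have ha : ∀ k ≤ m, ∑ j ∈ Finset.range k, a j • twist^[j] α ∈
      Submodule.span E (Set.range (fun j : ℕ => twist^[j] β)) → ∀ j < k, a j = 0 := by
    intro k hk
    induction k with
    | zero => intro _ j hj; omega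
    | succ k ih =>
      intro hmem
      have h0 : a k = 0 := by
        by_contra hne
        refine iterate_twist_notMem hβ hβ0 hgen (Nat.lt_of_succ_le hk) ?_
        rw [← Submodule.smul_mem_iff _ hne]
        rw [Finset.sum_range_succ] at hmem
        have h1 : ∑ j ∈ Finset.range k, a j • twist^[j] α ∈
            Submodule.span E (Set.range (fun j : ℕ => twist^[j] β) ∪
              Set.range (fun j : Fin k => twist^[j] α)) :=
          Submodule.sum_mem _ fun j hj => Submodule.smul_mem _ _
            (Submodule.subset_span (Or.inr ⟨⟨j, Finset.mem_range.mp hj⟩, rfl⟩))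
        exact (Submodule.add_mem_iff_right _ h1).mp
          (Submodule.span_mono Set.subset_union_left hmem)
      rw [Finset.sum_range_succ, h0, zero_smul, add_zero] at hmem
      intro j hj
      rcases Nat.lt_succ_iff_lt_or_eq.mp hj with hj | rfl
      · exact ih (by omega) hmem j hj
      · exact h0
  have ha0 := ha m le_rfl (by
    rw [eq_neg_of_add_eq_zero_left h]
    exact Submodule.neg_mem _ (Submodule.sum_mem _ fun j _ => Submodule.smul_mem _ _
      (Submodule.subset_span ⟨j, rfl⟩)))
  refine ⟨ha0, eq_zero_of_sum_twist_mem_degreeLT hβ hβ0 b n ?_⟩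
  rw [Finset.sum_eq_zero fun j hj => by rw [ha0 j (Finset.mem_range.mp hj), zero_smul],
    zero_add] at h
  rw [h]
  exact Submodule.zero_mem _

end Independence

/-! ### The differential of F⟨u⟩ and generation of E[∂] -/

section Generation

variable {F E : Type*} [Field F] [Field E] [Algebra F E]

/-- The differential of the field `F(x₀, x₁, …)` generated by algebraically independent `xₖ`,
with values in the free module on the `d xₖ`, written as `Xᵏ`. -/
theorem exists_derivation_adjoin {x : ℕ → E} (hx : AlgebraicIndependent F x) :
    ∃ d : E → E[X],
      (∀ a : F, d (algebraMap F E a) = 0) ∧ (∀ k, d (x k) = X ^ k) ∧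
      (∀ z ∈ IntermediateField.adjoin F (Set.range x),
        ∀ w ∈ IntermediateField.adjoin F (Set.range x), d (z + w) = d z + d w) ∧
      (∀ z ∈ IntermediateField.adjoin F (Set.range x),
        ∀ w ∈ IntermediateField.adjoin F (Set.range x), d (z * w) = z • d w + w • d z) := by
  classical
  -- A derivation d is encoded as the ring homomorphism z ↦ z + ε dz into the square-zero extension.
  -- There an element is a unit as soon as its first component is, so the homomorphism extends to
  -- fractions.
  let g : MvPolynomial ℕ F →ₐ[F] TrivSqZeroExt E E[X] :=
    MvPolynomial.aeval fun k => TrivSqZeroExt.inl (x k) + TrivSqZeroExt.inr (X ^ k)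
  have hg : ∀ p, (g p).fst = MvPolynomial.aeval x p := by
    intro p
    have : (TrivSqZeroExt.fstHom F E E[X]).comp g = MvPolynomial.aeval x := by
      ext k
      simp [g]
    exact DFunLike.congr_fun this p
  have hunit : ∀ y : nonZeroDivisors (MvPolynomial ℕ F), IsUnit (g y) := by
    intro y
    rw [TrivSqZeroExt.isUnit_iff_isUnit_fst, hg, isUnit_iff_ne_zero]
    intro h
    exact nonZeroDivisors.ne_zero y.2 (hx (by rw [h, map_zero]))
  let φ : FractionRing (MvPolynomial ℕ F) →ₐ[F] TrivSqZeroExt E E[X] :=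
    IsLocalization.liftAlgHom (M := nonZeroDivisors (MvPolynomial ℕ F)) hunit
  have hφ : ∀ p, φ (algebraMap _ _ p) = g p := fun p => IsLocalization.lift_eq _ p
  let ψ := φ.comp hx.aevalEquivField.symm.toAlgHom
  have hψ : ∀ z, (ψ z).fst = (z : E) := by
    intro z
    obtain ⟨r, rfl⟩ := hx.aevalEquivField.surjective z
    have h1 : ψ (hx.aevalEquivField r) = φ r := by simp [ψ]
    rw [h1]
    obtain ⟨p, q, rfl⟩ := IsLocalization.exists_mk'_eq (nonZeroDivisors (MvPolynomial ℕ F)) r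
    have hq : MvPolynomial.aeval x (q : MvPolynomial ℕ F) ≠ 0 := by
      intro h
      exact nonZeroDivisors.ne_zero q.2 (hx (by rw [h, map_zero]))
    have h2 := IsLocalization.mk'_spec (FractionRing (MvPolynomial ℕ F)) p q
    have h3 := congrArg (fun r => (φ r).fst) h2
    have h4 := congrArg (fun r => ((hx.aevalEquivField r : _) : E)) h2
    simp only [map_mul, hφ, TrivSqZeroExt.fst_mul, hg] at h3
    simp only [map_mul, MulMemClass.coe_mul, hx.aevalEquivField_algebraMap_apply_coe] at h4
    exact mul_right_cancel₀ hq (h3.trans h4.symm)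
  -- Outside the subfield d takes the junk value 0, which is why its rules carry membership
  -- hypotheses.
  refine ⟨fun z => if h : z ∈ IntermediateField.adjoin F (Set.range x) then (ψ ⟨z, h⟩).snd else 0,
    fun a => ?_, fun k => ?_, fun z hz w hw => ?_, fun z hz w hw => ?_⟩
  · have h := (IntermediateField.adjoin F (Set.range x)).algebraMap_mem a
    dsimp only
    rw [dif_pos h]
    have : (⟨algebraMap F E a, h⟩ : IntermediateField.adjoin F (Set.range x)) = algebraMap F _ a :=
      rfl
    rw [this, AlgHom.commutes]
    rfl
  · have h : x k ∈ IntermediateField.adjoin F (Set.range x) :=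
      IntermediateField.subset_adjoin _ _ ⟨k, rfl⟩
    dsimp only
    rw [dif_pos h]
    have : (⟨x k, h⟩ : IntermediateField.adjoin F (Set.range x)) =
        hx.aevalEquivField (algebraMap (MvPolynomial ℕ F) _ (MvPolynomial.X k)) := by
      ext1
      rw [hx.aevalEquivField_algebraMap_apply_coe, MvPolynomial.aeval_X]
    rw [this]
    have h1 : ∀ r, ψ (hx.aevalEquivField r) = φ r := fun r => by simp [ψ]
    rw [h1, hφ]
    simp [g]
  · dsimp only
    rw [dif_pos hz, dif_pos hw, dif_pos (add_mem hz hw), ← TrivSqZeroExt.snd_add, ← map_add]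
    rfl
  · dsimp only
    rw [dif_pos hz, dif_pos hw, dif_pos (mul_mem hz hw)]
    have : (⟨z * w, mul_mem hz hw⟩ : IntermediateField.adjoin F (Set.range x)) =
      ⟨z, hz⟩ * ⟨w, hw⟩ := rfl
    rw [this, map_mul, TrivSqZeroExt.snd_mul, hψ, hψ, op_smul_eq_smul]

variable [Differential E]

theorem diffAdjoin_singleton (u : E) :
    diffAdjoin F {u} = IntermediateField.adjoin F (Set.range fun k => iterDeriv k u) := by
  rw [diffAdjoin]
  congr 1
  ext b
  simp [eq_comm]

theorem iterDeriv_mem_diffAdjoin {S : Set E} {a : E} (ha : a ∈ S) (k : ℕ) :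
    iterDeriv k a ∈ diffAdjoin F S :=
  IntermediateField.subset_adjoin _ _ ⟨a, ha, k, rfl⟩

theorem deriv_inv (x : E) : (x⁻¹)′ = -(x⁻¹ * x⁻¹ * x′) := by
  by_cases hx : x = 0
  · simp [hx]
  · have h : (x * x⁻¹)′ = 0 := by rw [mul_inv_cancel₀ hx]; exact Derivation.map_one_eq_zero _
    rw [Derivation.leibniz, smul_eq_mul, smul_eq_mul] at h
    field_simp at h ⊢
    linear_combination h

/-- `d` is the differential of `F⟨u⟩`, for `u` differentially transcendental. It has values in
the operators `E[∂]`, where `∂ᵏ` stands for `d u⁽ᵏ⁾`, and it commutes with the derivation. -/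
structure IsDifferential (F : Type*) {E : Type*} [Field F] [Field E] [Algebra F E]
    [Differential E] (u : E) (d : E → E[X]) : Prop where
  map_algebraMap : ∀ a : F, d (algebraMap F E a) = 0
  map_iterDeriv : ∀ k, d (iterDeriv k u) = X ^ k
  map_add : ∀ z ∈ diffAdjoin F {u}, ∀ w ∈ diffAdjoin F {u}, d (z + w) = d z + d w
  map_mul : ∀ z ∈ diffAdjoin F {u}, ∀ w ∈ diffAdjoin F {u}, d (z * w) = z • d w + w • d z
  map_inv : ∀ z ∈ diffAdjoin F {u}, d z⁻¹ = -(z⁻¹ * z⁻¹) • d z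
  map_deriv : ∀ z ∈ diffAdjoin F {u}, d z′ = twist (d z)

variable [Differential F] [DifferentialAlgebra F E]

theorem deriv_mem_diffAdjoin {S : Set E} {z : E} (hz : z ∈ diffAdjoin F S) :
    z′ ∈ diffAdjoin F S := by
  induction hz using IntermediateField.adjoin_induction with
  | mem x hx =>
    obtain ⟨a, ha, k, rfl⟩ := hx
    rw [← iterDeriv_succ]
    exact iterDeriv_mem_diffAdjoin ha _
  | algebraMap x =>
    rw [DifferentialAlgebra.deriv_algebraMap]
    exact (diffAdjoin F S).algebraMap_mem _
  | add x y _ _ hx hy => rw [map_add]; exact add_mem hx hy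
  | inv x hx ih => rw [deriv_inv]; exact neg_mem (mul_mem (mul_mem (inv_mem hx) (inv_mem hx)) ih)
  | mul x y hx hy ihx ihy =>
    rw [Derivation.leibniz]
    exact add_mem (mul_mem hx ihy) (mul_mem hy ihx)

/-- The identity d z′ = ∂ dz holds on the u^(k) by the choice of basis and on F because both sides
vanish; it then propagates through the field operations. -/
theorem exists_isDifferential {u : E} (hu : IsDiffTranscendental F u) :
    ∃ d : E → E[X], IsDifferential F u d := by
  obtain ⟨d, hC, hX, hadd, hmul⟩ := exists_derivation_adjoin hu
  rw [← diffAdjoin_singleton] at hadd hmul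
  have hinv : ∀ z ∈ diffAdjoin F {u}, d z⁻¹ = -(z⁻¹ * z⁻¹) • d z := by
    intro z hz
    by_cases h0 : z = 0
    · have := hC 0
      rw [map_zero] at this
      simp [h0, this]
    · have h := hmul z hz z⁻¹ (inv_mem hz)
      have h1 := hC 1
      rw [map_one] at h1
      rw [mul_inv_cancel₀ h0, h1] at h
      have h2 : z⁻¹ • (z • d z⁻¹ + z⁻¹ • d z) = 0 := by rw [← h, smul_zero]
      rw [smul_add, smul_smul, smul_smul, inv_mul_cancel₀ h0, one_smul] at h2
      rw [neg_smul]
      exact eq_neg_of_add_eq_zero_left h2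
  refine ⟨d, hC, hX, hadd, hmul, hinv, fun z hz => ?_⟩
  have hz' := hz
  induction hz' using IntermediateField.adjoin_induction with
  | mem x hx =>
    obtain ⟨a, rfl, k, rfl⟩ := hx
    rw [← iterDeriv_succ, hX, hX, twist_X_pow]
  | algebraMap x => rw [DifferentialAlgebra.deriv_algebraMap, hC, hC, map_zero]
  | add x y hx hy ihx ihy =>
    rw [map_add, hadd _ (deriv_mem_diffAdjoin hx) _ (deriv_mem_diffAdjoin hy), hadd _ hx _ hy,
      map_add, ihx hx, ihy hy]
  | inv x hx ih =>
    have hx' := deriv_mem_diffAdjoin hx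
    have hn : -(x⁻¹ * x⁻¹) ∈ diffAdjoin F {u} := neg_mem (mul_mem (inv_mem hx) (inv_mem hx))
    -- This is d(-x⁻²) = 2x⁻³ dx, needed to differentiate (x⁻¹)′ = -x⁻²x′.
    have hdn : d (-(x⁻¹ * x⁻¹)) = (2 * x⁻¹ * x⁻¹ * x⁻¹) • d x := by
      have h1 := hmul _ ((diffAdjoin F {u}).algebraMap_mem (-1)) _ (mul_mem (inv_mem hx) (inv_mem hx))
      rw [hC, smul_zero, add_zero, map_neg, map_one, neg_one_mul, hmul _ (inv_mem hx) _ (inv_mem hx),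
        hinv x hx] at h1
      rw [h1]
      simp only [smul_smul, ← add_smul]
      congr 1
      ring
    rw [hinv x hx, twist_smul, ← ih hx, deriv_inv, neg_mul_eq_neg_mul, hmul _ hn _ hx', hdn,
      map_neg, Derivation.leibniz, deriv_inv, smul_smul, smul_eq_mul, add_comm]
    congr 2
    ring
  | mul x y hx hy ihx ihy =>
    have hx' := deriv_mem_diffAdjoin hx
    have hy' := deriv_mem_diffAdjoin hy
    rw [Derivation.leibniz, smul_eq_mul, smul_eq_mul, hadd _ (mul_mem hx hy') _ (mul_mem hy hx'),
      hmul _ hx _ hy', hmul _ hy _ hx', hmul _ hx _ hy, map_add, twist_smul, twist_smul,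
      ihx hx, ihy hy]
    abel

/-- If `F⟨ξ, η⟩ = F⟨u⟩`, then `d ξ` and `d η` generate the differentials of `F⟨u⟩` as a module
over the differential operators. -/
theorem eq_top_of_diffAdjoin_eq {u ξ η : E} (hgen : diffAdjoin F {ξ, η} = diffAdjoin F {u})
    {d : E → E[X]} (hd : IsDifferential F u d)
    (N : Submodule E E[X]) (hN : ∀ p ∈ N, twist p ∈ N) (hξ : d ξ ∈ N) (hη : d η ∈ N) : N = ⊤ := by
  have hsub : ∀ z ∈ diffAdjoin F {ξ, η}, z ∈ diffAdjoin F {u} := fun z hz => by rwa [← hgen]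
  have hiter : ∀ a ∈ diffAdjoin F {u}, d a ∈ N → ∀ k,
      iterDeriv k a ∈ diffAdjoin F {u} ∧ d (iterDeriv k a) ∈ N := by
    intro a ha hda k
    induction k with
    | zero => exact ⟨ha, hda⟩
    | succ k ih =>
      rw [iterDeriv_succ, hd.map_deriv _ ih.1]
      exact ⟨deriv_mem_diffAdjoin ih.1, hN _ ih.2⟩
  -- The condition dz ∈ N is preserved by the field operations, and by differentiation because N is
  -- stable under ∂.
  have hall : ∀ z ∈ diffAdjoin F {ξ, η}, d z ∈ N := by
    intro z hz
    induction hz using IntermediateField.adjoin_induction with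
    | mem x hx =>
      obtain ⟨a, ha, k, rfl⟩ := hx
      have hau : a ∈ diffAdjoin F {u} := hsub _ (iterDeriv_mem_diffAdjoin ha 0)
      rcases ha with rfl | rfl
      · exact (hiter _ hau hξ k).2
      · exact (hiter _ hau hη k).2
    | algebraMap x => rw [hd.map_algebraMap]; exact N.zero_mem
    | add x y hx hy ihx ihy =>
      rw [hd.map_add x (hsub _ hx) y (hsub _ hy)]
      exact N.add_mem ihx ihy
    | inv x hx ih => rw [hd.map_inv x (hsub _ hx)]; exact N.smul_mem _ ih
    | mul x y hx hy ihx ihy =>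
      rw [hd.map_mul x (hsub _ hx) y (hsub _ hy)]
      exact N.add_mem (N.smul_mem _ ihy) (N.smul_mem _ ihx)
  have hX : ∀ k, (X ^ k : E[X]) ∈ N := by
    intro k
    rw [← hd.map_iterDeriv k]
    refine hall _ ?_
    rw [hgen]
    exact iterDeriv_mem_diffAdjoin (Set.mem_singleton u) k
  rw [eq_top_iff]
  intro p _
  rw [p.as_sum_support]
  refine Submodule.sum_mem _ fun k _ => ?_
  rw [← smul_X_eq_monomial]
  exact N.smul_mem _ (hX k)

omit [Differential F] [DifferentialAlgebra F E] in
/-- The differential of an affine form. -/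
theorem differential_add_applyOp {u : E}
    {d : E → E[X]} (hd : IsDifferential F u d)
    (a : F) (p : F[X]) :
    algebraMap F E a + applyOp u (p.map (algebraMap F E)) ∈ diffAdjoin F {u} ∧
      d (algebraMap F E a + applyOp u (p.map (algebraMap F E))) = p.map (algebraMap F E) := by
  have h : applyOp u (p.map (algebraMap F E)) ∈ diffAdjoin F {u} ∧
      d (applyOp u (p.map (algebraMap F E))) = p.map (algebraMap F E) := by
    induction p using Polynomial.induction_on' with
    | add p q hp hq =>
      rw [Polynomial.map_add, map_add]
      exact ⟨add_mem hp.1 hq.1, by rw [hd.map_add _ hp.1 _ hq.1, hp.2, hq.2]⟩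
    | monomial k b =>
      rw [Polynomial.map_monomial, applyOp_monomial]
      have hb := (diffAdjoin F {u}).algebraMap_mem b
      have hk := iterDeriv_mem_diffAdjoin (F := F) (Set.mem_singleton u) k
      refine ⟨mul_mem hb hk, ?_⟩
      rw [hd.map_mul _ hb _ hk, hd.map_algebraMap, hd.map_iterDeriv, smul_zero, add_zero, smul_X_eq_monomial]
  have ha := (diffAdjoin F {u}).algebraMap_mem a
  exact ⟨add_mem ha h.1, by rw [hd.map_add _ ha _ h.1, hd.map_algebraMap, h.2, zero_add]⟩

end Generation

/-! ### Rows of the differential resultant matrix -/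

section Rows

variable {D : Type*} [CommRing D]

/-- The coefficient vector of the affine form `f.1 + ∑ f.2ₖ u⁽ᵏ⁾` with respect to
`u⁽ᴺ⁾, …, u', u, 1`. -/
def row (N : ℕ) : D × D[X] →ₗ[D] (Fin (N + 2) → D) where
  toFun f c := if (c : ℕ) ≤ N then f.2.coeff (N - c) else f.1
  map_add' f g := by ext c; dsimp; split_ifs <;> simp
  map_smul' a f := by ext c; dsimp; split_ifs <;> simp

theorem row_apply (N : ℕ) (f : D × D[X]) (c : Fin (N + 2)) :
    row N f c = if (c : ℕ) ≤ N then f.2.coeff (N - c) else f.1 := rfl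

/-- With order at most N no coefficient is lost, so relations between rows lift to relations between
affine forms. -/
theorem eq_zero_of_row_eq_zero {N : ℕ} {f : D × D[X]} (hf : f.2.natDegree ≤ N)
    (h : row N f = 0) : f = 0 := by
  ext k
  · have := congrFun h (Fin.last _)
    simpa [row_apply] using this
  · by_cases hk : k ≤ N
    · have := congrFun h ⟨N - k, by omega⟩
      rw [row_apply, if_pos (Nat.sub_le _ _)] at this
      simpa [Nat.sub_sub_self hk] using this
    · rw [coeff_eq_zero_of_natDegree_lt (by omega)]
      rfl

theorem map_row {E : Type*} [CommRing E] (σ : D →+* E) (N : ℕ) (f : D × D[X]) :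
    σ ∘ row N f = row N (σ f.1, f.2.map σ) := by
  ext c
  simp only [Function.comp_apply, row_apply, coeff_map]
  split_ifs <;> rfl

variable [Differential D]

/-- The affine forms `f⁽ᵐ²⁾, …, f', f, g⁽ᵐ¹⁾, …, g', g`, numbered from `0`. -/
def derivSeq (m₁ m₂ : ℕ) (f g : D × D[X]) (k : ℕ) : D × D[X] :=
  if k ≤ m₂ then (iterDeriv (m₂ - k) f.1, twist^[m₂ - k] f.2)
  else (iterDeriv (m₁ + m₂ + 1 - k) g.1, twist^[m₁ + m₂ + 1 - k] g.2)

theorem diffResultantMatrix_aff (m₁ m₂ : ℕ) (f g : D × D[X]) :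
    diffResultantMatrix m₁ m₂ (aff f.1 f.2) (aff g.1 g.2) =
      Matrix.of fun k : Fin (m₁ + m₂ + 2) => row (m₁ + m₂) (derivSeq m₁ m₂ f g k) := by
  ext k c
  simp only [diffResultantMatrix, Matrix.of_apply, row_apply, derivSeq]
  split_ifs <;> simp only [iterDeriv_aff, coeff_single_aff, coeff_zero_aff]

theorem map_derivSeq {E : Type*} [CommRing E] [Differential E] (σ : D →+* E)
    (hσ : ∀ a, σ a′ = (σ a)′) (m₁ m₂ : ℕ) (f g : D × D[X]) (k : ℕ) :
    (σ (derivSeq m₁ m₂ f g k).1, (derivSeq m₁ m₂ f g k).2.map σ) =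
      derivSeq m₁ m₂ (σ f.1, f.2.map σ) (σ g.1, g.2.map σ) k := by
  simp only [derivSeq]
  split_ifs <;> simp [map_iterDeriv σ hσ, iterate_twist_map σ hσ]

theorem natDegree_derivSeq_le {m₁ m₂ : ℕ} {f g : D × D[X]} (hf : f.2.natDegree ≤ m₁)
    (hg : g.2.natDegree ≤ m₂) (k : Fin (m₁ + m₂ + 2)) :
    (derivSeq m₁ m₂ f g k).2.natDegree ≤ m₁ + m₂ := by
  rw [derivSeq]
  split_ifs with h
  · have := natDegree_iterate_twist_le hf (m₂ - k)
    dsimp only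
    omega
  · have := natDegree_iterate_twist_le hg (m₁ + m₂ + 1 - k)
    dsimp only
    omega

theorem derivSeq_apply_eq_zero {m₁ m₂ : ℕ} {f g : D × D[X]} {u : D}
    (hf : f.1 + applyOp u f.2 = 0) (hg : g.1 + applyOp u g.2 = 0) (k : ℕ) :
    (derivSeq m₁ m₂ f g k).1 + applyOp u (derivSeq m₁ m₂ f g k).2 = 0 := by
  rw [derivSeq]
  split_ifs
  · simp only
    rw [applyOp_iterate_twist, ← iterDeriv_add, hf, iterDeriv_zero_right]
  · simp only
    rw [applyOp_iterate_twist, ← iterDeriv_add, hg, iterDeriv_zero_right]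

/-- Rows are numbered by decreasing derivative; reflecting both ranges indexes the terms by the
number j of differentiations. -/
theorem sum_smul_derivSeq {m₁ m₂ : ℕ} {f g : D × D[X]} (v : ℕ → D) :
    ∑ k : Fin (m₁ + m₂ + 2), v k • (derivSeq m₁ m₂ f g k).2 =
      ∑ j ∈ Finset.range (m₂ + 1), v (m₂ - j) • twist^[j] f.2 +
        ∑ j ∈ Finset.range (m₁ + 1), v (m₁ + m₂ + 1 - j) • twist^[j] g.2 := by
  rw [Fin.sum_univ_eq_sum_range (fun k => v k • (derivSeq m₁ m₂ f g k).2),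
    show m₁ + m₂ + 2 = (m₂ + 1) + (m₁ + 1) by omega, Finset.sum_range_add,
    ← Finset.sum_range_reflect _ (m₂ + 1), ← Finset.sum_range_reflect _ (m₁ + 1)]
  congr 1
  · refine Finset.sum_congr rfl fun j hj => ?_
    have hj := Finset.mem_range.mp hj
    rw [show m₂ + 1 - 1 - j = m₂ - j by omega, derivSeq, if_pos (by omega)]
    simp only [show m₂ - (m₂ - j) = j by omega]
  · refine Finset.sum_congr rfl fun j hj => ?_
    have hj := Finset.mem_range.mp hj
    rw [show m₂ + 1 + (m₁ + 1 - 1 - j) = m₁ + m₂ + 1 - j by omega, derivSeq, if_neg (by omega)]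
    simp only [show m₁ + m₂ + 1 - (m₁ + m₂ + 1 - j) = j by omega]

end Rows

/-! ### Nonvanishing of the specialized determinant -/

section Nonvanishing

variable {E : Type*} [Field E] [Differential E]

/-- Let `f` and `g` be affine forms with common zero `u`, whose linear parts generate `E[∂]`.
Replacing the row of the highest derivative of `f`, or of `g`, in the differential resultant
matrix by an affine form that does not vanish at `u` gives a nonsingular matrix. -/
theorem det_updateRow_derivSeq_ne_zero {m₁ m₂ : ℕ} {f g : E × E[X]} {u : E}
    (hf : f.2.natDegree ≤ m₁) (hf0 : f.2.coeff m₁ ≠ 0)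
    (hg : g.2.natDegree ≤ m₂) (hg0 : g.2.coeff m₂ ≠ 0)
    (hfu : f.1 + applyOp u f.2 = 0) (hgu : g.1 + applyOp u g.2 = 0)
    (hgen : ∀ N : Submodule E E[X], (∀ p ∈ N, twist p ∈ N) → f.2 ∈ N → g.2 ∈ N → N = ⊤)
    (k₀ : Fin (m₁ + m₂ + 2)) (hk₀ : (k₀ : ℕ) = 0 ∨ (k₀ : ℕ) = m₂ + 1)
    {h : E × E[X]} (hh : h.2.natDegree ≤ m₁ + m₂) (hhu : h.1 + applyOp u h.2 ≠ 0) :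
    ((Matrix.of fun k : Fin (m₁ + m₂ + 2) => row (m₁ + m₂) (derivSeq m₁ m₂ f g k)).updateRow k₀
      (row (m₁ + m₂) h)).det ≠ 0 := by
  classical
  intro hdet
  obtain ⟨v, hv0, hv⟩ := Matrix.exists_vecMul_eq_zero_iff.mpr hdet
  set w : Fin (m₁ + m₂ + 2) → E × E[X] :=
    Function.update (fun k => derivSeq m₁ m₂ f g k) k₀ h with hw
  have hrow : ∀ k, (Matrix.of fun k : Fin (m₁ + m₂ + 2) =>
      row (m₁ + m₂) (derivSeq m₁ m₂ f g k)).updateRow k₀ (row (m₁ + m₂) h) k =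
        row (m₁ + m₂) (w k) := by
    intro k
    by_cases hk : k = k₀
    · subst hk
      rw [Matrix.updateRow_self, hw, Function.update_self]
    · rw [Matrix.updateRow_ne hk, hw, Function.update_of_ne hk]
      rfl
  have hsum : ∑ k, v k • w k = 0 := by
    apply eq_zero_of_row_eq_zero (N := m₁ + m₂)
    · rw [Prod.snd_sum]
      refine natDegree_sum_le_of_forall_le _ _ fun k _ => ?_
      refine (natDegree_smul_le _ _).trans ?_
      by_cases hk : k = k₀
      · subst hk
        rwa [hw, Function.update_self]
      · rw [hw, Function.update_of_ne hk]
        exact natDegree_derivSeq_le hf hg k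
    · rw [map_sum, ← hv, Matrix.vecMul_eq_sum]
      refine Finset.sum_congr rfl fun k _ => ?_
      rw [map_smul, ← hrow]
  -- Evaluating the relation at u kills every form except h.
  have hvk : v k₀ = 0 := by
    have h1 := congrArg (LinearMap.coprod LinearMap.id (applyOp u)) hsum
    rw [map_sum, map_zero, Finset.sum_eq_single k₀] at h1
    · rw [map_smul, hw, Function.update_self] at h1
      exact (mul_eq_zero.mp h1).resolve_right (by simpa using hhu)
    · intro k _ hk
      rw [map_smul, hw, Function.update_of_ne hk]
      have := derivSeq_apply_eq_zero (m₁ := m₁) (m₂ := m₂) hfu hgu k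
      simp [this]
    · intro hk
      exact absurd (Finset.mem_univ _) hk
  -- Extension by zero to ℕ allows indices given by truncated subtraction.
  let V : ℕ → E := fun k => if hk : k < m₁ + m₂ + 2 then v ⟨k, hk⟩ else 0
  have hV : ∀ k : Fin (m₁ + m₂ + 2), V k = v k := fun k => by simp [V]
  have hsum2 : ∑ k : Fin (m₁ + m₂ + 2), V k • (derivSeq m₁ m₂ f g k).2 = 0 := by
    have h2 := congrArg Prod.snd hsum
    rw [Prod.snd_sum] at h2
    rw [← Prod.snd_zero (M := E), ← h2]
    refine Finset.sum_congr rfl fun k _ => ?_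
    rw [hV]
    by_cases hk : k = k₀
    · subst hk
      rw [hvk, zero_smul, zero_smul]
      rfl
    · rw [hw, Function.update_of_ne hk]
      rfl
  have hzero : ∀ k < m₁ + m₂ + 2, V k = 0 := by
    rw [sum_smul_derivSeq] at hsum2
    have hVk : V k₀ = 0 := by rw [hV, hvk]
    rcases hk₀ with hk₀ | hk₀
    -- Without row 0 there remain ∂ʲα for j < m₂ and ∂ʲβ for j ≤ m₁.
    · rw [hk₀] at hVk
      rw [Finset.sum_range_succ, Nat.sub_self, hVk, zero_smul, add_zero] at hsum2
      obtain ⟨h1, h2⟩ := eq_zero_of_sum_twist_add_sum_twist hg hg0 hgen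
        (fun j => V (m₂ - j)) (fun j => V (m₁ + m₂ + 1 - j)) _ hsum2
      intro k hk
      rcases Nat.eq_zero_or_pos k with rfl | hpos
      · exact hVk
      by_cases hkm : k ≤ m₂
      · have := h1 (m₂ - k) (by omega)
        rwa [Nat.sub_sub_self hkm] at this
      · have := h2 (m₁ + m₂ + 1 - k) (by omega)
        rwa [Nat.sub_sub_self (by omega)] at this
    -- Without row m₂ + 1 there remain ∂ʲα for j ≤ m₂ and ∂ʲβ for j < m₁; the roles of f and g are
    -- exchanged.
    · rw [hk₀] at hVk
      rw [Finset.sum_range_succ _ m₁, show m₁ + m₂ + 1 - m₁ = m₂ + 1 by omega, hVk, zero_smul,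
        add_zero, add_comm] at hsum2
      obtain ⟨h1, h2⟩ := eq_zero_of_sum_twist_add_sum_twist hf hf0
        (fun N hN h1 h2 => hgen N hN h2 h1)
        (fun j => V (m₁ + m₂ + 1 - j)) (fun j => V (m₂ - j)) _ hsum2
      intro k hk
      by_cases hkm : k ≤ m₂
      · have := h2 (m₂ - k) (by omega)
        rwa [Nat.sub_sub_self hkm] at this
      · rcases (show m₂ + 1 ≤ k by omega).eq_or_lt with rfl | hlt
        · exact hVk
        have := h1 (m₁ + m₂ + 1 - k) (by omega)
        rwa [Nat.sub_sub_self (by omega)] at this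
  refine hv0 (funext fun k => ?_)
  rw [← hV, hzero k k.2]
  rfl

end Nonvanishing

/-! ### Degree and order of a determinant in one variable -/

section Degree

variable {τ K : Type*} [Field K]

theorem degreeOf_eq_zero_of_mem_supported {s : Set τ} {v : τ} (hv : v ∉ s)
    {p : MvPolynomial τ K} (hp : p ∈ MvPolynomial.supported K s) : p.degreeOf v = 0 := by
  classical
  by_contra h
  refine hv (MvPolynomial.mem_supported.mp hp ?_)
  rw [MvPolynomial.degreeOf_def] at h
  rw [Finset.mem_coe, MvPolynomial.vars_def]
  exact Multiset.mem_toFinset.mpr (Multiset.count_ne_zero.mp h)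

theorem degreeOf_X_mul_add {s : Set τ} {v : τ} (hv : v ∉ s) {S T : MvPolynomial τ K}
    (hS : S ∈ MvPolynomial.supported K s) (hT : T ∈ MvPolynomial.supported K s) (hS0 : S ≠ 0) :
    MvPolynomial.degreeOf v (MvPolynomial.X v * S + T) = 1 := by
  have h1 : MvPolynomial.degreeOf v (MvPolynomial.X v * S) = 1 := by
    rw [MvPolynomial.degreeOf_mul_eq (MvPolynomial.X_ne_zero (R := K) v) hS0,
      degreeOf_eq_zero_of_mem_supported hv hS, MvPolynomial.degreeOf_X_self]
  rw [MvPolynomial.degreeOf_add_eq_of_degreeOf_lt, h1]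
  rw [h1, degreeOf_eq_zero_of_mem_supported hv hT]
  exact one_pos

theorem det_mem_supported {n : Type*} [Fintype n] [DecidableEq n] {s : Set τ}
    {M : Matrix n n (MvPolynomial τ K)} (hM : ∀ i j, M i j ∈ MvPolynomial.supported K s) :
    M.det ∈ MvPolynomial.supported K s := by
  rw [Matrix.det_apply']
  exact Subalgebra.sum_mem _ fun σ _ => Subalgebra.mul_mem _ (Subalgebra.intCast_mem _ _)
    (Subalgebra.prod_mem _ fun i _ => hM _ _)

/-- A matrix in which a variable `v` occurs in one row only, and linearly there, has a determinant
that is linear in `v`. -/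
theorem degreeOf_det {n : Type*} [Fintype n] [DecidableEq n] {s : Set τ} {v : τ} (hv : v ∉ s)
    {M : Matrix n n (MvPolynomial τ K)} {k₀ : n} {r t : n → MvPolynomial τ K}
    (hk₀ : M k₀ = (MvPolynomial.X v : MvPolynomial τ K) • r + t)
    (hr : ∀ j, r j ∈ MvPolynomial.supported K s) (ht : ∀ j, t j ∈ MvPolynomial.supported K s)
    (hM : ∀ i, i ≠ k₀ → ∀ j, M i j ∈ MvPolynomial.supported K s)
    (hdet : (M.updateRow k₀ r).det ≠ 0) :
    MvPolynomial.degreeOf v M.det = 1 ∧ M.det ∈ MvPolynomial.supported K (insert v s) := by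
  have hmem : ∀ r : n → MvPolynomial τ K, (∀ j, r j ∈ MvPolynomial.supported K s) →
      (M.updateRow k₀ r).det ∈ MvPolynomial.supported K s := by
    intro r hr
    refine det_mem_supported fun i j => ?_
    by_cases hi : i = k₀
    · subst hi
      rw [Matrix.updateRow_self]
      exact hr j
    · rw [Matrix.updateRow_ne hi]
      exact hM i hi j
  have h : M.det = MvPolynomial.X v * (M.updateRow k₀ r).det + (M.updateRow k₀ t).det := by
    rw [← Matrix.det_updateRow_smul, ← Matrix.det_updateRow_add, ← hk₀, Matrix.updateRow_eq_self]
  rw [h]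
  refine ⟨degreeOf_X_mul_add hv (hmem r hr) (hmem t ht) hdet, ?_⟩
  have hle := MvPolynomial.supported_mono (R := K) (Set.subset_insert v s)
  exact add_mem (mul_mem (MvPolynomial.X_mem_supported.mpr (Set.mem_insert v s))
    (hle (hmem r hr))) (hle (hmem t ht))

theorem ord_eq_of_degreeOf {ι : Type*} {i : ι} {m : ℕ} {R : DiffPoly ι K}
    (hdeg : R.degreeOf (i, m) = 1)
    (hR : R ∈ MvPolynomial.supported K (insert (i, m) {v : ι × ℕ | v.1 = i → v.2 < m})) :
    ord i R = m := by
  classical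
  have hmem : (i, m) ∈ R.vars := by
    by_contra h
    have := degreeOf_eq_zero_of_mem_supported (s := (R.vars : Set (ι × ℕ))) (v := (i, m))
      (by simpa using h) (MvPolynomial.mem_supported_vars R)
    omega
  rw [ord]
  apply le_antisymm
  · refine Finset.sup_le fun v hv => ?_
    have hv' : v ∈ R.vars ∧ v.1 = i := by simpa using hv
    rcases MvPolynomial.mem_supported.mp hR hv'.1 with rfl | h
    · exact le_rfl
    · exact_mod_cast (h hv'.2).le
  · refine Finset.le_sup (f := fun v : ι × ℕ => (v.2 : WithBot ℕ)) (b := (i, m)) ?_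
    simpa using hmem

end Degree

/-! ### Differential substitution and the variables in each row -/

section Specialization

variable {ι F E : Type*} [Field F] [Differential F] [Field E] [Differential E] [Algebra F E]
  [DifferentialAlgebra F E]

/-- The differential substitution `F{y_i : i ∈ ι} → E`, `y_i ↦ ζ i`. -/
def specialize (ζ : ι → E) : DiffPoly ι F →ₐ[F] E :=
  MvPolynomial.aeval fun v : ι × ℕ => iterDeriv v.2 (ζ v.1)

omit [Differential F] [DifferentialAlgebra F E] in
theorem specialize_X (ζ : ι → E) (v : ι × ℕ) :
    specialize (F := F) ζ (MvPolynomial.X v) = iterDeriv v.2 (ζ v.1) :=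
  MvPolynomial.aeval_X _ _

omit [Differential F] [DifferentialAlgebra F E] in
theorem specialize_C (ζ : ι → E) (a : F) :
    specialize ζ (MvPolynomial.C a : DiffPoly ι F) = algebraMap F E a :=
  MvPolynomial.aeval_C _ _

theorem specialize_deriv (ζ : ι → E) (p : DiffPoly ι F) :
    specialize ζ p′ = (specialize ζ p)′ := by
  induction p using MvPolynomial.induction_on with
  | C a => rw [deriv_C, specialize_C, specialize_C, DifferentialAlgebra.deriv_algebraMap]
  | add p q hp hq => simp only [map_add, hp, hq]
  | mul_X p v hp =>
    rw [Derivation.leibniz, map_mul, Derivation.leibniz, deriv_X]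
    simp only [smul_eq_mul, map_add, map_mul, hp, specialize_X, iterDeriv_succ]

theorem deriv_mem_supported {i : ι} {j : ℕ} {p : DiffPoly ι F}
    (hp : p ∈ MvPolynomial.supported F {v : ι × ℕ | v.1 = i ∧ v.2 < j}) :
    p′ ∈ MvPolynomial.supported F {v : ι × ℕ | v.1 = i ∧ v.2 < j + 1} := by
  have hle : MvPolynomial.supported F {v : ι × ℕ | v.1 = i ∧ v.2 < j} ≤
      MvPolynomial.supported F {v : ι × ℕ | v.1 = i ∧ v.2 < j + 1} :=
    MvPolynomial.supported_mono fun v hv => ⟨hv.1, hv.2.trans (Nat.lt_succ_self j)⟩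
  rw [MvPolynomial.supported_eq_adjoin_X] at hp
  induction hp using Algebra.adjoin_induction with
  | mem x hx =>
    obtain ⟨v, hv, rfl⟩ := hx
    rw [deriv_X]
    exact MvPolynomial.X_mem_supported.mpr ⟨hv.1, Nat.succ_lt_succ hv.2⟩
  | algebraMap a =>
    rw [MvPolynomial.algebraMap_eq, deriv_C]
    exact Subalgebra.algebraMap_mem _ _
  | add x y _ _ hx hy => rw [map_add]; exact add_mem hx hy
  | mul x y hx hy ihx ihy =>
    rw [Derivation.leibniz]
    exact add_mem (mul_mem (hle hx) ihy) (mul_mem (hle hy) ihx)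

omit [Differential F] in
theorem C_mem_supported (s : Set (ι × ℕ)) (a : F) :
    (MvPolynomial.C a : DiffPoly ι F) ∈ MvPolynomial.supported F s :=
  Subalgebra.algebraMap_mem _ _

/-- Each differentiation raises the top derivative by one and keeps its coefficient b; all other
terms involve lower derivatives. -/
theorem exists_iterDeriv_eqConst (i : Fin 2) (a b : F) (j : ℕ) :
    ∃ s ∈ MvPolynomial.supported F {v : Fin 2 × ℕ | v.1 = i ∧ v.2 < j},
      iterDeriv j (eqConst i a b) = MvPolynomial.X (i, j) * MvPolynomial.C b + s := by
  induction j with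
  | zero => exact ⟨-MvPolynomial.C a, neg_mem (C_mem_supported _ _), sub_eq_add_neg _ _⟩
  | succ j ih =>
    obtain ⟨s, hs, h⟩ := ih
    refine ⟨MvPolynomial.X (i, j) * MvPolynomial.C b′ + s′, add_mem (mul_mem ?_ ?_) ?_, ?_⟩
    · exact MvPolynomial.X_mem_supported.mpr ⟨rfl, Nat.lt_succ_self j⟩
    · exact C_mem_supported _ _
    · exact deriv_mem_supported hs
    · rw [iterDeriv_succ, h, map_add, Derivation.leibniz, deriv_X, deriv_C, smul_eq_mul,
        smul_eq_mul]
      ring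

theorem exists_iterate_twist_eqOp (i : Fin 2) (p q : F[X]) (j : ℕ) :
    ∃ s : (DiffPoly (Fin 2) F)[X],
      (∀ k, s.coeff k ∈ MvPolynomial.supported F {v : Fin 2 × ℕ | v.1 = i ∧ v.2 < j}) ∧
      twist^[j] (eqOp i p q) = (MvPolynomial.X (i, j) : DiffPoly (Fin 2) F) •
        q.map (MvPolynomial.C : F →+* DiffPoly (Fin 2) F) + s := by
  induction j with
  | zero =>
    refine ⟨-p.map (MvPolynomial.C : F →+* DiffPoly (Fin 2) F), fun k => ?_, sub_eq_add_neg _ _⟩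
    rw [coeff_neg, coeff_map]
    exact neg_mem (C_mem_supported _ _)
  | succ j ih =>
    obtain ⟨s, hs, h⟩ := ih
    have hle : MvPolynomial.supported F {v : Fin 2 × ℕ | v.1 = i ∧ v.2 < j} ≤
        MvPolynomial.supported F {v : Fin 2 × ℕ | v.1 = i ∧ v.2 < j + 1} :=
      MvPolynomial.supported_mono fun v hv => ⟨hv.1, hv.2.trans (Nat.lt_succ_self j)⟩
    refine ⟨(MvPolynomial.X (i, j) : DiffPoly (Fin 2) F) •
      (twist q).map (MvPolynomial.C : F →+* DiffPoly (Fin 2) F) + twist s, fun k => ?_, ?_⟩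
    · rw [coeff_add, coeff_smul, coeff_map]
      refine add_mem (mul_mem ?_ (C_mem_supported _ _)) ?_
      · exact MvPolynomial.X_mem_supported.mpr ⟨rfl, Nat.lt_succ_self j⟩
      · cases k with
        | zero =>
          rw [twist_coeff_zero]
          exact deriv_mem_supported (hs 0)
        | succ k =>
          rw [twist_coeff_succ]
          exact add_mem (deriv_mem_supported (hs _)) (hle (hs k))
    · rw [Function.iterate_succ_apply', h, map_add, twist_smul, deriv_X,
        twist_map _ (fun a => (deriv_C a).symm), add_assoc]

/-- The row of `(x Q(u) - P(u))⁽ʲ⁾` in the differential resultant matrix. -/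
theorem exists_row_eq (N : ℕ) (i : Fin 2) (a b : F) (p q : F[X]) (j : ℕ) :
    ∃ t : Fin (N + 2) → DiffPoly (Fin 2) F,
      (∀ c, t c ∈ MvPolynomial.supported F {v : Fin 2 × ℕ | v.1 = i ∧ v.2 < j}) ∧
      row N (iterDeriv j (eqConst i a b), twist^[j] (eqOp i p q)) =
        (MvPolynomial.X (i, j) : DiffPoly (Fin 2) F) • row N
          ((MvPolynomial.C b, q.map MvPolynomial.C) :
            DiffPoly (Fin 2) F × (DiffPoly (Fin 2) F)[X]) + t := by
  obtain ⟨s₁, hs₁, h₁⟩ := exists_iterDeriv_eqConst i a b j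
  obtain ⟨s₂, hs₂, h₂⟩ := exists_iterate_twist_eqOp i p q j
  refine ⟨row N (s₁, s₂), fun c => ?_, ?_⟩
  · rw [row_apply]
    split_ifs
    · exact hs₂ _
    · exact hs₁
  · rw [← map_smul, ← map_add, h₁, h₂]
    rfl

omit [Differential F] in
theorem row_C_mem_supported (N : ℕ) (b : F) (q : F[X]) (s : Set (Fin 2 × ℕ))
    (c : Fin (N + 2)) :
    row N ((MvPolynomial.C b, q.map MvPolynomial.C) :
      DiffPoly (Fin 2) F × (DiffPoly (Fin 2) F)[X]) c ∈ MvPolynomial.supported F s := by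
  rw [row_apply]
  split_ifs
  · rw [coeff_map]
    exact C_mem_supported _ _
  · exact C_mem_supported _ _

theorem row_mem_supported (N : ℕ) (i : Fin 2) (a b : F) (p q : F[X]) {j : ℕ}
    {s : Set (Fin 2 × ℕ)} (hs : ∀ k ≤ j, (i, k) ∈ s) (c : Fin (N + 2)) :
    row N (iterDeriv j (eqConst i a b), twist^[j] (eqOp i p q)) c ∈
      MvPolynomial.supported F s := by
  obtain ⟨t, ht, h⟩ := exists_row_eq N i a b p q j
  rw [h]
  refine add_mem (mul_mem (MvPolynomial.X_mem_supported.mpr (hs j le_rfl))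
    (row_C_mem_supported N b q s c)) (MvPolynomial.supported_mono ?_ (ht c))
  rintro ⟨i', k⟩ ⟨rfl, hk⟩
  exact hs k (le_of_lt hk)

omit [Differential F] [DifferentialAlgebra F E] in
theorem specialize_eqConst (ζ : Fin 2 → E) (i : Fin 2) (a b : F) :
    specialize ζ (eqConst i a b) = ζ i * algebraMap F E b - algebraMap F E a := by
  rw [eqConst, map_sub, map_mul, specialize_X, specialize_C, specialize_C]
  rfl

omit [Differential F] [DifferentialAlgebra F E] in
theorem map_specialize_C (ζ : Fin 2 → E) (p : F[X]) :
    (p.map (MvPolynomial.C : F →+* DiffPoly (Fin 2) F)).map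
      (specialize ζ : DiffPoly (Fin 2) F →ₐ[F] E).toRingHom = p.map (algebraMap F E) := by
  ext k
  simp only [coeff_map]
  exact specialize_C ζ _

omit [Differential F] [DifferentialAlgebra F E] in
theorem map_specialize_eqOp (ζ : Fin 2 → E) (i : Fin 2) (p q : F[X]) :
    (eqOp i p q).map (specialize ζ : DiffPoly (Fin 2) F →ₐ[F] E).toRingHom =
      ζ i • q.map (algebraMap F E) - p.map (algebraMap F E) := by
  rw [eqOp, Polynomial.map_sub, Polynomial.map_smul, map_specialize_C, map_specialize_C]
  congr 2
  exact specialize_X ζ (i, 0)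

end Specialization

/-! ### Affine forms attached to a reduced fraction -/

section Parametrization

variable {F E : Type*} [Field F] [Field E] [Differential E] [Algebra F E] {u : E}

theorem diffEval_injective (hu : IsDiffTranscendental F u) :
    Function.Injective (diffEval (F := F) u) :=
  hu.comp (fun v : Unit × ℕ => v.2) fun _ _ h => Prod.ext rfl h

theorem diffEval_aff (a : F) (p : F[X]) :
    diffEval u (aff a p) = algebraMap F E a + applyOp u (p.map (algebraMap F E)) :=
  aeval_aff u a p

/-- A fraction of nonnegative order in reduced form is not a constant of `F`. -/
theorem diffEval_div_notMem_range (hu : IsDiffTranscendental F u) {P Q : DiffPoly Unit F}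
    (hQ : Q ≠ 0) (hPQ : IsRelPrime P Q) {m : ℕ} (hm : fracOrd P Q = m) (c : F) :
    diffEval u P / diffEval u Q ≠ algebraMap F E c := by
  intro h
  have hQu : diffEval u Q ≠ 0 := by
    intro h0
    refine hQ (diffEval_injective hu ?_)
    rw [h0, diffEval, map_zero]
  have hP : P = MvPolynomial.C c * Q := by
    apply diffEval_injective hu
    rw [div_eq_iff hQu] at h
    rw [h, diffEval, diffEval, map_mul, MvPolynomial.aeval_C]
  -- Q divides both P = cQ and itself; being a unit, it is a constant, and so is P, which
  -- contradicts the order m ≥ 0.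
  have hunit : IsUnit Q := hPQ (hP ▸ dvd_mul_left _ _) dvd_rfl
  obtain ⟨b, -, rfl⟩ := MvPolynomial.isUnit_iff_eq_C_of_isReduced.mp hunit
  rw [hP, ← MvPolynomial.C_mul, fracOrd, ord, ord, MvPolynomial.vars_C, MvPolynomial.vars_C] at hm
  simp at hm

/-- A reduced fraction `ζ = P(u) / Q(u)` of affine forms, of order `m`: the affine form
`ζ Q - P` has order `m` and zero `u`, and its linear part is a multiple of `d ζ`. -/
theorem exists_aff_of_fracOrd (hu : IsDiffTranscendental F u) {d : E → E[X]}
    (hd : IsDifferential F u d) {P Q : DiffPoly Unit F}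
    (hQ : Q ≠ 0) (hP1 : P.totalDegree ≤ 1) (hQ1 : Q.totalDegree ≤ 1) (hPQ : IsRelPrime P Q)
    {m : ℕ} (hm : fracOrd P Q = m) {ζ : E} (hζ : ζ = diffEval u P / diffEval u Q) :
    ∃ (a b : F) (p q : F[X]), P = aff a p ∧ Q = aff b q ∧
      max p.degree q.degree = m ∧
      (ζ • q.map (algebraMap F E) - p.map (algebraMap F E)).natDegree ≤ m ∧
      (ζ • q.map (algebraMap F E) - p.map (algebraMap F E)).coeff m ≠ 0 ∧
      (ζ * algebraMap F E b - algebraMap F E a) +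
        applyOp u (ζ • q.map (algebraMap F E) - p.map (algebraMap F E)) = 0 ∧
      algebraMap F E b + applyOp u (q.map (algebraMap F E)) ≠ 0 ∧
      ∀ N : Submodule E E[X],
        ζ • q.map (algebraMap F E) - p.map (algebraMap F E) ∈ N → d ζ ∈ N := by
  have hnot := diffEval_div_notMem_range hu hQ hPQ hm
  rw [← hζ] at hnot
  have hQu : diffEval u Q ≠ 0 := by
    intro h0
    refine hQ (diffEval_injective hu ?_)
    rw [h0, diffEval, map_zero]
  have hmul : ζ * diffEval u Q = diffEval u P := by rw [hζ, div_mul_cancel₀ _ hQu]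
  obtain ⟨a, p, rfl⟩ := exists_eq_aff hP1
  obtain ⟨b, q, rfl⟩ := exists_eq_aff hQ1
  rw [fracOrd, ord_aff, ord_aff] at hm
  rw [diffEval_aff] at hQu
  rw [diffEval_aff, diffEval_aff] at hmul hζ
  have hp : p.natDegree ≤ m := natDegree_le_of_degree_le (hm ▸ le_max_left _ _)
  have hq : q.natDegree ≤ m := natDegree_le_of_degree_le (hm ▸ le_max_right _ _)
  refine ⟨a, b, p, q, rfl, rfl, hm, ?_, ?_, ?_, hQu, fun N hN => ?_⟩
  · refine (natDegree_sub_le _ _).trans (max_le ?_ (natDegree_map_le.trans hp))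
    exact (natDegree_smul_le _ _).trans (natDegree_map_le.trans hq)
  · rw [coeff_sub, coeff_smul, coeff_map, coeff_map, smul_eq_mul]
    intro h
    -- If ζ q_m = p_m, then either q_m = p_m = 0, against the choice of m, or ζ = p_m / q_m lies in
    -- F.
    by_cases hq0 : q.coeff m = 0
    · rw [hq0, map_zero, mul_zero, zero_sub, neg_eq_zero, map_eq_zero] at h
      rcases max_choice p.degree q.degree with h1 | h1
      · exact coeff_ne_zero_of_eq_degree (h1.symm.trans hm) h
      · exact coeff_ne_zero_of_eq_degree (h1.symm.trans hm) hq0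
    · refine hnot (p.coeff m / q.coeff m) ?_
      rw [map_div₀, eq_div_iff (by rwa [Ne, map_eq_zero])]
      exact sub_eq_zero.mp h
  · rw [map_sub, map_smul, smul_eq_mul]
    linear_combination hmul
  -- Differentiating ζ Q(u) = P(u) gives Q(u) dζ = -(ζq - p), and Q(u) is invertible.
  · obtain ⟨hP, hdP⟩ := differential_add_applyOp hd a p
    obtain ⟨hQ, hdQ⟩ := differential_add_applyOp hd b q
    have hζmem : ζ ∈ diffAdjoin F {u} := hζ ▸ div_mem hP hQ
    have h := hd.map_mul _ hζmem _ hQ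
    rw [hmul, hdP, hdQ] at h
    rw [← N.smul_mem_iff hQu]
    convert N.neg_mem hN using 1
    rw [h]
    abel

end Parametrization

/-! ### Degree and order of the resultant -/

section Main

variable {F E : Type*} [Field F] [Differential F] [Field E] [Differential E] [Algebra F E]
  [DifferentialAlgebra F E]

/-- Row 0 is the only one containing x^(m₂), and row m₂ + 1 the only one containing y^(m₁), since
the other rows of the same form are differentiated fewer times. -/
theorem degreeOf_det_derivSeq {m₁ m₂ : ℕ} (a b : Fin 2 → F) (p q : Fin 2 → F[X])
    (hdet : ∀ (i : Fin 2) (k₀ : Fin (m₁ + m₂ + 2)), (k₀ : ℕ) = (if i = 0 then 0 else m₂ + 1) →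
      ((Matrix.of fun k : Fin (m₁ + m₂ + 2) => row (m₁ + m₂) (derivSeq m₁ m₂
        (eqConst 0 (a 0) (b 0), eqOp 0 (p 0) (q 0))
        (eqConst 1 (a 1) (b 1), eqOp 1 (p 1) (q 1)) k)).updateRow k₀
          (row (m₁ + m₂) ((MvPolynomial.C (b i), (q i).map MvPolynomial.C) :
            DiffPoly (Fin 2) F × (DiffPoly (Fin 2) F)[X]))).det ≠ 0)
    (i : Fin 2) {m : ℕ} (hm : m = if i = 0 then m₂ else m₁) :
    let R := (Matrix.of fun k : Fin (m₁ + m₂ + 2) => row (m₁ + m₂) (derivSeq m₁ m₂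
        (eqConst 0 (a 0) (b 0), eqOp 0 (p 0) (q 0))
        (eqConst 1 (a 1) (b 1), eqOp 1 (p 1) (q 1)) k)).det
    MvPolynomial.degreeOf (i, m) R = 1 ∧ ord i R = m := by
  intro R
  let k₀ : Fin (m₁ + m₂ + 2) := ⟨if i = 0 then 0 else m₂ + 1, by split_ifs <;> omega⟩
  obtain ⟨t, ht, hrow⟩ := exists_row_eq (m₁ + m₂) i (a i) (b i) (p i) (q i) m
  -- The set s leaves the other differential variable unrestricted and excludes only derivatives of
  -- order at least m of the variable i.
  have h := degreeOf_det (s := {v : Fin 2 × ℕ | v.1 = i → v.2 < m}) (v := (i, m))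
    (M := Matrix.of fun k : Fin (m₁ + m₂ + 2) => row (m₁ + m₂) (derivSeq m₁ m₂
        (eqConst 0 (a 0) (b 0), eqOp 0 (p 0) (q 0))
        (eqConst 1 (a 1) (b 1), eqOp 1 (p 1) (q 1)) k)) (k₀ := k₀)
    (r := row (m₁ + m₂) ((MvPolynomial.C (b i), (q i).map MvPolynomial.C) :
            DiffPoly (Fin 2) F × (DiffPoly (Fin 2) F)[X])) (t := t)
    (fun h => lt_irrefl _ (h rfl)) ?_ (row_C_mem_supported _ _ _ _)
    (fun c => MvPolynomial.supported_mono (fun v hv _ => hv.2) (ht c)) ?_ (hdet i k₀ rfl)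
  · exact ⟨h.1, ord_eq_of_degreeOf h.1 h.2⟩
  · rw [← hrow]
    change row (m₁ + m₂) (derivSeq m₁ m₂ _ _ (if i = 0 then 0 else m₂ + 1)) = _
    fin_cases i
    · simp only [derivSeq, Fin.zero_eta, if_true, zero_le, Nat.sub_zero] at hm ⊢
      rw [hm]
    · have h1 : ¬ m₂ + 1 ≤ m₂ := by omega
      have h2 : m₁ + m₂ + 1 - (m₂ + 1) = m₁ := by omega
      simp only [derivSeq, Fin.mk_one, one_ne_zero, if_false, h1, h2] at hm ⊢
      rw [hm]
  · intro k hk c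
    have hk' : (k : ℕ) ≠ if i = 0 then 0 else m₂ + 1 := fun h => hk (Fin.ext h)
    change row (m₁ + m₂) (derivSeq m₁ m₂ _ _ k) c ∈ _
    rw [derivSeq]
    split_ifs with hkm
    · refine row_mem_supported _ _ _ _ _ _ ?_ c
      intro j hj h0
      dsimp only at h0
      subst h0
      rw [if_pos rfl] at hk' hm
      subst hm
      dsimp only
      omega
    · refine row_mem_supported _ _ _ _ _ _ ?_ c
      intro j hj h0
      dsimp only at h0
      subst h0
      rw [if_neg one_ne_zero] at hk' hm
      subst hm
      dsimp only
      omega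

end Main

end DiffAlg

end

theorem mainTheorem5 {F E : Type*} [Field F] [CharZero F] [Differential F]
    [Field E] [Differential E] [Algebra F E] [DifferentialAlgebra F E]
    (u : E) (hu : DiffAlg.IsDiffTranscendental F u)
    (P₁ Q₁ P₂ Q₂ : DiffAlg.DiffPoly Unit F)
    (hparam : DiffAlg.IsLinearDiffRatParam u P₁ Q₁ P₂ Q₂)
    (m₁ m₂ : ℕ)
    (hm₁ : DiffAlg.fracOrd P₁ Q₁ = (m₁ : WithBot ℕ))
    (hm₂ : DiffAlg.fracOrd P₂ Q₂ = (m₂ : WithBot ℕ))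
    (hproper : DiffAlg.IsProperParam u P₁ Q₁ P₂ Q₂)
    (R : DiffAlg.DiffPoly (Fin 2) F)
    (hR : R = DiffAlg.diffResultant
      (DiffAlg.implicitEq 0 P₁ Q₁) (DiffAlg.implicitEq 1 P₂ Q₂)) :
    R ≠ 0 ∧
      DiffAlg.ord 0 R = (m₂ : WithBot ℕ) ∧
      DiffAlg.ord 1 R = (m₁ : WithBot ℕ) ∧
      R.degreeOf (0, m₂) = 1 ∧
      R.degreeOf (1, m₁) = 1 := by
  classical
  open DiffAlg in
  obtain ⟨d, hd⟩ := exists_isDifferential hu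
  set ξ := diffEval u P₁ / diffEval u Q₁ with hξ
  set η := diffEval u P₂ / diffEval u Q₂ with hη
  obtain ⟨a₁, b₁, p₁, q₁, rfl, rfl, hord₁, hdeg₁, hlc₁, hzero₁, hden₁, hmem₁⟩ :=
    exists_aff_of_fracOrd hu hd hparam.denom_ne_zero₁ hparam.degree_num₁ hparam.degree_denom₁
      hparam.reduced₁ hm₁ hξ
  obtain ⟨a₂, b₂, p₂, q₂, rfl, rfl, hord₂, hdeg₂, hlc₂, hzero₂, hden₂, hmem₂⟩ :=
    exists_aff_of_fracOrd hu hd hparam.denom_ne_zero₂ hparam.degree_num₂ hparam.degree_denom₂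
      hparam.reduced₂ hm₂ hη
  have hgen : ∀ N : Submodule E (Polynomial E), (∀ p ∈ N, twist p ∈ N) →
      ξ • q₁.map (algebraMap F E) - p₁.map (algebraMap F E) ∈ N →
      η • q₂.map (algebraMap F E) - p₂.map (algebraMap F E) ∈ N → N = ⊤ :=
    fun N hN h1 h2 => eq_top_of_diffAdjoin_eq hproper hd N hN (hmem₁ N h1) (hmem₂ N h2)
  have hq₁ : q₁.natDegree ≤ m₁ :=
    Polynomial.natDegree_le_of_degree_le (hord₁ ▸ le_max_right _ _)
  have hq₂ : q₂.natDegree ≤ m₂ :=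
    Polynomial.natDegree_le_of_degree_le (hord₂ ▸ le_max_right _ _)
  -- The substitution x ↦ ξ, y ↦ η commutes with the derivations, so it carries the matrix to the
  -- one built from the specialized forms.
  let σ : DiffPoly (Fin 2) F →+* E := (specialize (F := F) ![ξ, η]).toRingHom
  have hσ : ∀ a, σ a′ = (σ a)′ := specialize_deriv ![ξ, η]
  have hf : (σ (eqConst 0 a₁ b₁), (eqOp 0 p₁ q₁).map σ) =
      (ξ * algebraMap F E b₁ - algebraMap F E a₁,
        ξ • q₁.map (algebraMap F E) - p₁.map (algebraMap F E)) :=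
    Prod.ext (specialize_eqConst ![ξ, η] 0 _ _) (map_specialize_eqOp ![ξ, η] 0 _ _)
  have hg : (σ (eqConst 1 a₂ b₂), (eqOp 1 p₂ q₂).map σ) =
      (η * algebraMap F E b₂ - algebraMap F E a₂,
        η • q₂.map (algebraMap F E) - p₂.map (algebraMap F E)) :=
    Prod.ext (specialize_eqConst ![ξ, η] 1 _ _) (map_specialize_eqOp ![ξ, η] 1 _ _)
  rw [implicitEq_aff, implicitEq_aff, diffResultant, ord_aff, ord_aff, degree_eqOp, degree_eqOp,
    hord₁, hord₂] at hR
  change R = (diffResultantMatrix m₁ m₂ _ _).det at hR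
  rw [diffResultantMatrix_aff m₁ m₂ (eqConst 0 a₁ b₁, eqOp 0 p₁ q₁)
    (eqConst 1 a₂ b₂, eqOp 1 p₂ q₂)] at hR
  have hdet : ∀ (k₀ : Fin (m₁ + m₂ + 2)), (k₀ : ℕ) = 0 ∨ (k₀ : ℕ) = m₂ + 1 →
      ∀ (b : F) (q : Polynomial F), q.natDegree ≤ m₁ + m₂ →
      algebraMap F E b + applyOp u (q.map (algebraMap F E)) ≠ 0 →
      ((Matrix.of fun k : Fin (m₁ + m₂ + 2) => row (m₁ + m₂) (derivSeq m₁ m₂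
        (eqConst 0 a₁ b₁, eqOp 0 p₁ q₁) (eqConst 1 a₂ b₂, eqOp 1 p₂ q₂) k)).updateRow k₀
          (row (m₁ + m₂) ((MvPolynomial.C b, q.map MvPolynomial.C) :
            DiffPoly (Fin 2) F × Polynomial (DiffPoly (Fin 2) F)))).det ≠ 0 := by
    intro k₀ hk₀ b q hq hbq h0
    -- A determinant that vanishes in F{x, y} would also vanish after specialization.
    have h1 := congrArg σ h0
    rw [map_zero, RingHom.map_det, RingHom.mapMatrix_apply, Matrix.map_updateRow, map_row] at h1
    refine det_updateRow_derivSeq_ne_zero (f := (ξ * algebraMap F E b₁ - algebraMap F E a₁,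
      ξ • q₁.map (algebraMap F E) - p₁.map (algebraMap F E)))
      (g := (η * algebraMap F E b₂ - algebraMap F E a₂,
        η • q₂.map (algebraMap F E) - p₂.map (algebraMap F E)))
      (h := (algebraMap F E b, q.map (algebraMap F E)))
      hdeg₁ hlc₁ hdeg₂ hlc₂ hzero₁ hzero₂ hgen k₀ hk₀ (Polynomial.natDegree_map_le.trans hq) hbq ?_
    rw [← h1]
    congr 2
    · ext k c
      rw [Matrix.map_apply, Matrix.of_apply, Matrix.of_apply]
      refine Eq.trans ?_ (congrFun (map_row σ _ _).symm c)
      rw [map_derivSeq σ hσ, hf, hg]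
    · exact congrArg (row (m₁ + m₂))
        (Prod.ext (specialize_C _ _).symm (map_specialize_C _ _).symm)
  have hmain := degreeOf_det_derivSeq (m₁ := m₁) (m₂ := m₂) ![a₁, a₂] ![b₁, b₂] ![p₁, p₂]
    ![q₁, q₂] (by
      intro i k₀ hk₀
      fin_cases i
      · exact hdet k₀ (Or.inl hk₀) b₁ q₁ (by omega) hden₁
      · exact hdet k₀ (Or.inr hk₀) b₂ q₂ (by omega) hden₂)
  have hx := hmain 0 (m := m₂) rfl
  have hy := hmain 1 (m := m₁) rfl
  have hx1 : R.degreeOf (0, m₂) = 1 := by rw [hR]; exact hx.1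
  refine ⟨?_, by rw [hR]; exact hx.2, by rw [hR]; exact hy.2, hx1, by rw [hR]; exact hy.1⟩
  rintro rfl
  rw [MvPolynomial.degreeOf_zero] at hx1
  exact zero_ne_one hx1
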